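/- For each $n\ge 1$ let $z_0^n\in\mathbb{R}^n$, let $B^n$ be a standard $n$-dimensional Brownian motion, and let $Z^n=(Z^n_t)_{t\ge0}$ be the Ornstein–Uhlenbeck process on $\mathbb{R}^n$ solving $$Z_0^n=z_0^n,\qquad \mathrm{d}Z_t^n=\sqrt{\tfrac{2}{n}}\,\mathrm{d}B_t^n-Z_t^n\,\mathrm{d}t .$$ Let $P_n^0=\mathcal{N}(0,\frac1n I_n)$ be its invariant law, and let $|\cdot|$ be the Euclidean norm. For probability measures $\mu,\nu$ on $\mathbb{R}^n$ define, with values in $[0,+\infty]$: $\mathrm{TV}(\mu\mid\nu)=\sup_A|\mu(A)-\nu(A)|$ (supremum over Borel sets); $\mathrm{Hellinger}(\mu\mid\nu)=\bigl(\int\frac12(\sqrt{f_\mu}-\sqrt{f_\nu})^2\,\mathrm{d}\lambda\bigr)^{1/2}$, where $f_\mu,f_\nu$ are the densities of $\mu,\nu$ with respect to a common reference measure $\lambda$ (the value does not depend on $\lambda$; e.g. $\lambda=\mu+\nu$); $\mathrm{Kullback}(\mu\mid\nu)=\int\log\frac{\mathrm{d}\mu}{\mathrm{d}\nu}\,\mathrm{d}\mu$;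 $\chi^2(\mu\mid\nu)=\int\bigl|\frac{\mathrm{d}\mu}{\mathrm{d}\nu}-1\bigr|^2\mathrm{d}\nu$; $\mathrm{Fisher}(\mu\mid\nu)=\int\bigl|\nabla\log\frac{\mathrm{d}\mu}{\mathrm{d}\nu}\bigr|^2\mathrm{d}\mu=4\int\bigl|\nabla\sqrt{\tfrac{\mathrm{d}\mu}{\mathrm{d}\nu}}\bigr|^2\mathrm{d}\nu$ (weak gradient; $\nu$ having a positive density); Kullback, $\chi^2$ and Fisher being $+\infty$ if $\mu$ is not absolutely continuous with respect to $\nu$; and $\mathrm{Wasserstein}(\mu,\nu)=\bigl(\inf\mathbb{E}[|X-Y|^2]\bigr)^{1/2}$, the infimum running over all couples $(X,Y)$ with $X\sim\mu$ and $Y\sim\nu$. Put $\max=1$ for TV and Hellinger, and $\max=+\infty$ for Kullback, $\chi^2$, Fisher and Wasserstein. Say that there is *cutoff* in $\mathrm{dist}$ at the times $c_n$ if for every $\varepsilon\in(0,1)$ $$\lim_{n\to\infty}\mathrm{dist}(\mathrm{Law}(Z^n_{t_n})\mid P_n^0)=\begin{cases}\max&\text{if }t_n=(1-\varepsilon)c_n,\\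 0&\text{if }t_n=(1+\varepsilon)c_n.\end{cases}$$ **Theorem.** 1. Without any assumption on the initial conditions $z_0^n$, for each $\mathrm{dist}\in\{\mathrm{TV},\mathrm{Hellinger},\mathrm{Kullback},\chi^2,\mathrm{Fisher}\}$ there is cutoff in $\mathrm{dist}$ at $$c_n=\begin{cases}\log(\sqrt n\,|z_0^n|)\vee\frac14\log n&\text{if }\mathrm{dist}\in\{\mathrm{TV},\mathrm{Hellinger},\mathrm{Kullback},\chi^2\},\\ \log(n|z_0^n|)\vee\frac12\log n&\text{if }\mathrm{dist}=\mathrm{Fisher}.\end{cases}$$ (with $\log 0=-\infty$). 2. If $\lim_{n\to\infty}|z_0^n|=+\infty$, then there is cutoff in Wasserstein at $c_n=\log|z_0^n|$. 3. If $\lim_{n\to\infty}|z_0^n|=\alpha\in[0,\infty)$, then there is no cutoff in Wasserstein (at any sequence of times $c_n$); more precisely, for every $t>0$, $$\lim_{n\to\infty}\mathrm{Wasserstein}^2(\mathrm{Law}(Z_t^n),P_n^0)=\alpha^2\mathrm{e}^{-2t}+2\Bigl(1-\sqrt{1-\mathrm{e}^{-2t}}-\tfrac12\mathrm{e}^{-2t}\Bigr).$$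 -/

import Mathlib

open MeasureTheory ProbabilityTheory Filter Topology
open scoped NNReal ENNReal

namespace OUCutoff

noncomputable section

/-! ### The Ornstein-Uhlenbeck process -/

/-- `B` is a standard `n`-dimensional Brownian motion under `P`: its coordinates are standard
real Brownian motions (with almost surely continuous paths) and are independent as processes. -/
structure IsStdBrownian {Ω : Type*} [MeasurableSpace Ω] {n : ℕ}
    (B : ℝ≥0 → Ω → EuclideanSpace ℝ (Fin n)) (P : Measure Ω) : Prop where
  isBrownianReal : ∀ i : Fin n, IsBrownianReal (fun t ω => B t ω i) P
  iIndepFun : iIndepFun (fun (i : Fin n) (ω : Ω) (t : ℝ≥0) => B t ω i) P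

/-- `Z` is a solution of the stochastic differential equation
`Z 0 = z₀`, `dZ = √(2/n) dB - Z dt`: it is a process with almost surely continuous paths such that,
almost surely, `Z t = z₀ + √(2/n) B t - ∫ s in 0..t, Z s` for all `t ≥ 0`. (The noise being
additive, no stochastic integral is needed.) -/
structure IsOUProcess {Ω : Type*} [MeasurableSpace Ω] {n : ℕ}
    (z₀ : EuclideanSpace ℝ (Fin n)) (B Z : ℝ≥0 → Ω → EuclideanSpace ℝ (Fin n))
    (P : Measure Ω) : Prop where
  aemeasurable : ∀ t, AEMeasurable (Z t) P
  continuous : ∀ᵐ ω ∂P, Continuous fun t => Z t ω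
  sde : ∀ᵐ ω ∂P, ∀ t : ℝ≥0,
    Z t ω = z₀ + √(2 / (n : ℝ)) • B t ω - ∫ s in (0 : ℝ)..t, Z s.toNNReal ω

/-- The invariant law `𝒩(0, Iₙ / n)` of the process. -/
def invariantLaw (n : ℕ) : Measure (EuclideanSpace ℝ (Fin n)) :=
  multivariateGaussian 0 ((n : ℝ)⁻¹ • (1 : Matrix (Fin n) (Fin n) ℝ))

/-! ### Distances and divergences -/

/-- The Wasserstein distance of order `2`: the square root of the infimum of `𝔼 |X - Y|²` over all
couplings, that is over all laws `π` of couples `(X, Y)` with marginals `μ` and `ν`. -/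
def wasserstein {E : Type*} [MeasurableSpace E] [PseudoEMetricSpace E] (μ ν : Measure E) : ℝ≥0∞ :=
  (⨅ (π : Measure (E × E)) (_ : π.map Prod.fst = μ ∧ π.map Prod.snd = ν),
    ∫⁻ p, edist p.1 p.2 ^ 2 ∂π) ^ (1 / 2 : ℝ)

/-- The total variation distance `sup_A |μ(A) - ν(A)|`, over measurable sets `A`. -/
def totalVariation {E : Type*} [MeasurableSpace E] (μ ν : Measure E) : ℝ≥0∞ :=
  ⨆ (A : Set E) (_ : MeasurableSet A), ENNReal.ofReal |μ.real A - ν.real A|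

/-- The Hellinger distance `(∫ ½ (√f_μ - √f_ν)² dλ)^{1/2}`, where `f_μ` and `f_ν` are the densities
of `μ` and `ν` with respect to the reference measure `λ = μ + ν`. -/
def hellinger {E : Type*} [MeasurableSpace E] (μ ν : Measure E) : ℝ≥0∞ :=
  (∫⁻ x, ENNReal.ofReal (1 / 2 *
    (√(μ.rnDeriv (μ + ν) x).toReal - √(ν.rnDeriv (μ + ν) x).toReal) ^ 2) ∂(μ + ν)) ^ (1 / 2 : ℝ)

open Classical in
/-- The `χ²` divergence `∫ (dμ/dν - 1)² dν`, infinite if `μ` is not absolutely continuous with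
respect to `ν`. -/
def chiSquare {E : Type*} [MeasurableSpace E] (μ ν : Measure E) : ℝ≥0∞ :=
  if μ ≪ ν then ∫⁻ x, ENNReal.ofReal (((μ.rnDeriv ν x).toReal - 1) ^ 2) ∂ν else ∞

/-- `G` is a weak (distributional) gradient of `u`, with respect to the Lebesgue measure. -/
structure IsWeakGradient {n : ℕ} (u : EuclideanSpace ℝ (Fin n) → ℝ)
    (G : EuclideanSpace ℝ (Fin n) → EuclideanSpace ℝ (Fin n)) : Prop where
  locallyIntegrable : LocallyIntegrable u
  locallyIntegrable_grad : LocallyIntegrable G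
  integral_eq : ∀ φ : EuclideanSpace ℝ (Fin n) → ℝ, ContDiff ℝ (⊤ : ℕ∞) φ → HasCompactSupport φ →
    ∀ v, ∫ x, u x * fderiv ℝ φ x v = -∫ x, φ x * inner ℝ (G x) v

open Classical in
/-- The Fisher information `∫ |∇ log (dμ/dν)|² dμ = 4 ∫ |∇ √(dμ/dν)|² dν` of `μ` relative to a
measure `ν` with the same null sets as the Lebesgue measure. The gradient is the weak gradient, it
is unique almost everywhere; the value is infinite if there is no weak gradient, or if `μ` is not
absolutely continuous with respect to `ν`. -/
def fisher {n : ℕ} (μ ν : Measure (EuclideanSpace ℝ (Fin n))) : ℝ≥0∞ :=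
  if μ ≪ ν then
    ⨅ (G : EuclideanSpace ℝ (Fin n) → EuclideanSpace ℝ (Fin n))
      (_ : IsWeakGradient (fun x => √(μ.rnDeriv ν x).toReal) G), 4 * ∫⁻ x, ‖G x‖ₑ ^ 2 ∂ν
  else ∞

/-- The names of the distances and divergences. -/
inductive Dist where
  | wasserstein
  | tv
  | hellinger
  | kullback
  | chiSquare
  | fisher

/-- The value `dist(μ ∣ ν)`. -/
def Dist.eval {n : ℕ} (d : Dist) (μ ν : Measure (EuclideanSpace ℝ (Fin n))) : ℝ≥0∞ :=
  match d with
  | .wasserstein => OUCutoff.wasserstein μ ν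
  | .tv => totalVariation μ ν
  | .hellinger => OUCutoff.hellinger μ ν
  | .kullback => InformationTheory.klDiv μ ν
  | .chiSquare => OUCutoff.chiSquare μ ν
  | .fisher => OUCutoff.fisher μ ν

/-- The maximal value of each distance or divergence. -/
def Dist.max : Dist → ℝ≥0∞
  | .tv | .hellinger => 1
  | .wasserstein | .kullback | .chiSquare | .fisher => ∞

/-! ### Cutoff -/

/-- The critical time in dimension `n` for an initial condition of Euclidean norm `r`.
For `r = 0`, where the mathematical value of the first logarithm is `-∞`, the convention
`Real.log 0 = 0` gives the same maximum, since `log n ≥ 0`. -/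
def Dist.criticalTime (d : Dist) (n : ℕ) (r : ℝ) : ℝ :=
  match d with
  | .wasserstein => Real.log r
  | .tv | .hellinger | .kullback | .chiSquare =>
    Real.log (√(n : ℝ) * r) ⊔ (1 / 4 * Real.log n)
  | .fisher => Real.log (n * r) ⊔ (1 / 2 * Real.log n)

/-- The laws `μ n t` (law at time `t` in dimension `n`) have a cutoff in `d` towards `ν n` at the
critical times `c n`. (Times are truncated at `0`.) -/
def HasCutoff (d : Dist) (μ : (n : ℕ) → ℝ≥0 → Measure (EuclideanSpace ℝ (Fin n)))
    (ν : (n : ℕ) → Measure (EuclideanSpace ℝ (Fin n))) (c : ℕ → ℝ) : Prop :=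
  ∀ ε : ℝ, 0 < ε → ε < 1 →
    Tendsto (fun n => d.eval (μ n ((1 - ε) * c n).toNNReal) (ν n)) atTop (𝓝 d.max) ∧
    Tendsto (fun n => d.eval (μ n ((1 + ε) * c n).toNNReal) (ν n)) atTop (𝓝 0)

end

end OUCutoff

/-! Everything rests on the explicit law: variation of constants gives `Z t = e^{-t} z₀ + √(2/n)
e^{-t} ∫ e^s dB`, so the law at time `t` is Gaussian with mean `m = e^{-t} z₀` and covariance `((1 -
a)/n) Iₙ`, where `a = e^{-2t}`. The Wiener integral is reached as a pathwise limit of finite sums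
whose characteristic functions are explicit (`IsOUProcess.map_eq`).

For TV, Hellinger, Kullback and `χ²` the relevant quantity is `Q = n a² + n |m|²`. Gaussian
integrals give `χ² ≤ e^Q - 1` for `a² ≤ 1/2`, and `b ≤ e^{-Q/16}` for the Bhattacharyya coefficient
`b = ∫ √f dν` of the density `f`. General inequalities transfer these bounds: TV and Hellinger are
at most `√χ²`, and Kullback is at most `χ²`; in the other direction TV is at least `1 - b`, squared
Hellinger equals `1 - b`, and Kullback is at least `-2 log b`. Hence `Q → 0` forces all four to `0`,
and `Q → ∞` forces them to their maxima. Fisher is computed exactly as `n² a² / (1 - a) + n² |m|²`.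

In both cases the controlling quantity is `A² e^{-2t} + B² e^{-4t}`, with `(A, B) = (√n |z₀|, √n)`
or `(n |z₀|, n)`. It crosses from large to small at `c = log A ∨ ½ log B`: it is at most `e^{2(c-t)}
+ e^{4(c-t)}`, and at least `e^{2(c-t)}` before `c`.

The squared Wasserstein distance equals `|m|² + (1 - √(1 - a))²`, by a linear coupling and a
quadratic dual bound. The second term stays in `[0, 1]`, so only `|z₀| → ∞` can produce cutoff. -/

namespace OUCutoff

/-! ### Pathwise calculus: Riemann–Stieltjes sums and variation of constants -/

/-- Riemann-Stieltjes sums over the regular subdivisions of `[0, t]` converge. -/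
lemma tendsto_sum_mul_sub_regular {f g g' : ℝ → ℝ} {t θ : ℝ} (ht : 0 ≤ t) (hθ : 0 ≤ θ)
    (hθ' : θ ≤ 1) (hf : Continuous f) (hg : ∀ x, HasDerivAt g (g' x) x) (hg' : Continuous g') :
    Tendsto (fun N : ℕ => ∑ k ∈ Finset.range N,
      f ((k + θ) * (t / N)) * (g (((k + 1 : ℕ) : ℝ) * (t / N)) - g (k * (t / N))))
      atTop (𝓝 (∫ x in (0 : ℝ)..t, f x * g' x)) := by
  obtain ⟨M, hM⟩ := (isCompact_Icc (a := (0 : ℝ)) (b := t)).exists_bound_of_continuousOn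
    hg'.continuousOn
  have hM0 : 0 ≤ M := (norm_nonneg _).trans (hM 0 ⟨le_rfl, ht⟩)
  have huc := (isCompact_Icc (a := (0 : ℝ)) (b := t)).uniformContinuousOn_of_continuous
    hf.continuousOn
  rw [Metric.tendsto_atTop]
  intro ε hε
  -- With `|g'| ≤ M`, the errors add up to `ε M t / (M t + 1) < ε`; the `+ 1` covers the case `M t =
  -- 0`.
  obtain ⟨δ, hδ, hfδ⟩ := Metric.uniformContinuousOn_iff.1 huc (ε / (M * t + 1)) (by positivity)
  obtain ⟨N₀, hN₀⟩ := exists_nat_gt (t / δ)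
  refine ⟨N₀ + 1, fun N hN => ?_⟩
  have hNpos : (0 : ℝ) < N := by
    have : 0 < N := by omega
    exact_mod_cast this
  set h : ℝ := t / N with hh
  have h0 : 0 ≤ h := by positivity
  have hNh : N * h = t := by rw [hh]; field_simp
  have hhδ : h < δ := by
    rw [hh, div_lt_iff₀ hNpos]
    rw [div_lt_iff₀ hδ] at hN₀
    have : (N₀ : ℝ) ≤ N := by exact_mod_cast (by omega : N₀ ≤ N)
    nlinarith
  have hint : ∀ a b, IntervalIntegrable (fun x => f x * g' x) volume a b :=
    fun a b => (hf.mul hg').intervalIntegrable a b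
  have hsplit : ∫ x in (0 : ℝ)..t, f x * g' x
      = ∑ k ∈ Finset.range N, ∫ x in (k * h)..((k + 1 : ℕ) * h), f x * g' x := by
    rw [intervalIntegral.sum_integral_adjacent_intervals (a := fun k : ℕ => (k : ℝ) * h)
      fun k _ => hint _ _]
    simp [hNh]
  have hterm : ∀ k ∈ Finset.range N,
      |f ((k + θ) * h) * (g (((k + 1 : ℕ) : ℝ) * h) - g (k * h))
        - ∫ x in (k * h)..((k + 1 : ℕ) * h), f x * g' x| ≤ ε / (M * t + 1) * M * h := by
    intro k hk
    have hkN : ((k : ℝ) + 1) ≤ N := by exact_mod_cast Finset.mem_range.1 hk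
    have hk0 : (0 : ℝ) ≤ k := Nat.cast_nonneg k
    have hle : (k : ℝ) * h ≤ (k + 1 : ℕ) * h := by push_cast; nlinarith
    have hgint : g (((k + 1 : ℕ) : ℝ) * h) - g (k * h)
        = ∫ x in (k * h)..((k + 1 : ℕ) * h), g' x :=
      (intervalIntegral.integral_eq_sub_of_hasDerivAt (fun x _ => hg x)
        (hg'.intervalIntegrable _ _)).symm
    rw [hgint, ← intervalIntegral.integral_const_mul, ← intervalIntegral.integral_sub
      ((hg'.const_mul _).intervalIntegrable _ _) (hint _ _), ← Real.norm_eq_abs]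
    have := intervalIntegral.norm_integral_le_of_norm_le_const (a := k * h) (b := (k + 1 : ℕ) * h)
      (f := fun x => f ((k + θ) * h) * g' x - f x * g' x) (C := ε / (M * t + 1) * M) ?_
    · refine this.trans_eq ?_
      rw [abs_of_nonneg (by linarith)]; push_cast; ring
    · intro x hx
      rw [Set.uIoc_of_le hle] at hx
      push_cast at hx
      have hkh : 0 ≤ k * h := by positivity
      have hkt : (k + 1) * h ≤ t := by rw [← hNh]; exact mul_le_mul_of_nonneg_right hkN h0
      have hx' : x ∈ Set.Icc 0 t := ⟨by linarith [hx.1], hx.2.trans hkt⟩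
      have hξ1 : k * h ≤ (k + θ) * h := by nlinarith
      have hξ2 : (k + θ) * h ≤ (k + 1) * h := by nlinarith
      have hd : dist ((k + θ) * h) x < δ := by
        rw [Real.dist_eq, abs_lt]
        constructor <;> nlinarith [hx.1, hx.2]
      have := hfδ _ ⟨hkh.trans hξ1, hξ2.trans hkt⟩ x hx' hd
      rw [← sub_mul, norm_mul]
      exact mul_le_mul (by rw [← dist_eq_norm]; exact this.le) (hM x hx') (norm_nonneg _)
        (by positivity)
  rw [Real.dist_eq, hsplit, ← Finset.sum_sub_distrib]
  calc _ ≤ ∑ k ∈ Finset.range N, ε / (M * t + 1) * M * h :=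
        (Finset.abs_sum_le_sum_abs _ _).trans (Finset.sum_le_sum hterm)
    _ = ε * ((M * t) / (M * t + 1)) := by
        rw [Finset.sum_const, Finset.card_range, nsmul_eq_mul, ← hNh]; ring
    _ < ε * 1 := by
        gcongr
        rw [div_lt_one (by positivity)]
        linarith
    _ = ε := mul_one ε

/-- Variation of constants for the integrated linear equation `z = z₀ + w - ∫ z`. -/
lemma exp_mul_eq_of_eq_sub_integral {z w : ℝ → ℝ} {z₀ : ℝ} (hz : Continuous z)
    (h : ∀ t, 0 ≤ t → z t = z₀ + w t - ∫ s in (0 : ℝ)..t, z s) {t : ℝ} (ht : 0 ≤ t) :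
    Real.exp t * z t = z₀ + (Real.exp t * w t - ∫ s in (0 : ℝ)..t, w s * Real.exp s) := by
  have hI : ∀ x, HasDerivAt (fun u => ∫ s in (0 : ℝ)..u, z s) (z x) x := fun x =>
    intervalIntegral.integral_hasDerivAt_right (hz.intervalIntegrable _ _)
      hz.stronglyMeasurable.stronglyMeasurableAtFilter hz.continuousAt
  -- The equation says `z₀ - ∫ z = z - w`, so on `[0, t]` this derivative collapses to `-w e^x`. The
  -- path `w` is never differentiated.
  have hd : ∀ x, HasDerivAt (fun u => Real.exp u * (z₀ - ∫ s in (0 : ℝ)..u, z s))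
      (Real.exp x * (z₀ - ∫ s in (0 : ℝ)..x, z s) + Real.exp x * (- z x)) x := fun x =>
    (Real.hasDerivAt_exp x).mul ((hI x).const_sub z₀)
  have hIc : Continuous fun u => ∫ s in (0 : ℝ)..u, z s :=
    continuous_iff_continuousAt.2 fun x => (hI x).continuousAt
  have hftc := intervalIntegral.integral_eq_sub_of_hasDerivAt (a := 0) (b := t)
    (fun x _ => hd x) (Continuous.intervalIntegrable (by fun_prop) _ _)
  have hcongr : ∫ x in (0 : ℝ)..t,
      (Real.exp x * (z₀ - ∫ s in (0 : ℝ)..x, z s) + Real.exp x * (- z x))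
      = ∫ x in (0 : ℝ)..t, -(w x * Real.exp x) := by
    refine intervalIntegral.integral_congr fun x hx => ?_
    rw [Set.uIcc_of_le ht] at hx
    have := h x hx.1
    rw [this]; ring
  rw [hcongr, intervalIntegral.integral_neg] at hftc
  simp only [intervalIntegral.integral_same, Real.exp_zero, sub_zero, one_mul] at hftc
  rw [h t ht]
  linarith

/-! ### Riemann sums for the Wiener integral of the exponential -/

/-- The `k`-th point of the regular subdivision of `[0, t]` in `N` pieces. -/
noncomputable def gridPoint (t : ℝ≥0) (N k : ℕ) : ℝ≥0 := k * (t / N)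

lemma coe_gridPoint (t : ℝ≥0) (N k : ℕ) : (gridPoint t N k : ℝ) = k * (t / N) := by
  simp [gridPoint]

lemma monotone_gridPoint (t : ℝ≥0) (N : ℕ) : Monotone (gridPoint t N) := fun i j hij => by
  unfold gridPoint
  gcongr

/-- Riemann sum for the Wiener integral `∫ e^s dB` over `[0, t]`. -/
noncomputable def expWienerSum (t : ℝ≥0) (N : ℕ) (b : ℝ≥0 → ℝ) : ℝ :=
  ∑ k ∈ Finset.range N,
    Real.exp (gridPoint t N k) * (b (gridPoint t N (k + 1)) - b (gridPoint t N k))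

lemma measurable_expWienerSum (t : ℝ≥0) (N : ℕ) : Measurable (expWienerSum t N) := by
  unfold expWienerSum
  fun_prop

/-- The variance of the Riemann sum `expWienerSum t N` of a Brownian motion. -/
noncomputable def expWienerVar (t : ℝ≥0) (N : ℕ) : ℝ :=
  ∑ k ∈ Finset.range N, Real.exp (gridPoint t N k) ^ 2 * (t / N)

lemma tendsto_expWienerVar (t : ℝ≥0) :
    Tendsto (expWienerVar t) atTop (𝓝 ((Real.exp (2 * t) - 1) / 2)) := by
  -- Left endpoints, `θ = 0`, since the Wiener sum samples `e^s` at the start of each interval.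
  have h := tendsto_sum_mul_sub_regular (f := fun s => Real.exp (2 * s)) (g := id)
    (g' := fun _ => 1) (t := t) t.2 le_rfl zero_le_one (by fun_prop) (fun x => hasDerivAt_id x)
    continuous_const
  have hI : ∫ x in (0 : ℝ)..t, Real.exp (2 * x) * 1 = (Real.exp (2 * t) - 1) / 2 := by
    simp [mul_one, intervalIntegral.integral_comp_mul_left]
    ring
  rw [hI] at h
  refine h.congr fun N => ?_
  unfold expWienerVar
  refine Finset.sum_congr rfl fun k _ => ?_
  rw [coe_gridPoint, ← Real.exp_nat_mul]
  push_cast [id]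
  rw [add_zero]
  ring

/-- Brownian paths have unbounded variation, so the sum is not directly a Riemann–Stieltjes sum
against `b`. Summation by parts moves the increments onto the smooth function `exp`, after which
continuity of `b` suffices. -/
lemma tendsto_expWienerSum {t : ℝ≥0} {b : ℝ≥0 → ℝ} (hb : Continuous b) (hb0 : b 0 = 0) :
    Tendsto (fun N => expWienerSum t N b) atTop
      (𝓝 (Real.exp t * b t - ∫ s in (0 : ℝ)..t, b s.toNNReal * Real.exp s)) := by
  -- Summation by parts evaluates `b` at right endpoints, hence `θ = 1`.
  have h := tendsto_sum_mul_sub_regular (f := fun s => b s.toNNReal) (g := Real.exp)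
    (g' := Real.exp) (t := t) t.2 zero_le_one le_rfl (hb.comp continuous_real_toNNReal)
    Real.hasDerivAt_exp Real.continuous_exp
  refine (h.const_sub (Real.exp t * b t)).congr' ?_
  filter_upwards [eventually_gt_atTop 0] with N hN
  have hN' : (N : ℝ≥0) ≠ 0 := by exact_mod_cast hN.ne'
  have htel := Finset.sum_range_sub (fun k => Real.exp (gridPoint t N k) * b (gridPoint t N k)) N
  have hgN : gridPoint t N N = t := by unfold gridPoint; field_simp
  have hg0 : gridPoint t N 0 = 0 := by simp [gridPoint]
  rw [hgN, hg0, hb0, mul_zero, sub_zero] at htel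
  rw [← htel, ← Finset.sum_sub_distrib]
  refine Finset.sum_congr rfl fun k _ => ?_
  have hk : ((k : ℝ) + 1) * (t / N) = gridPoint t N (k + 1) := by rw [coe_gridPoint]; push_cast; rfl
  rw [hk, Real.toNNReal_coe, ← coe_gridPoint, ← coe_gridPoint]
  ring

/-- The increments over the grid are independent centred Gaussians of variance `t / N`, so the
characteristic function factorises and the variances add. -/
lemma charFun_map_expWienerSum {Ω : Type*} [MeasurableSpace Ω] {P : Measure Ω}
    {b : ℝ≥0 → Ω → ℝ} (hb : IsPreBrownianReal b P) (t : ℝ≥0) (N : ℕ) (ξ : ℝ) :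
    charFun (P.map fun ω => expWienerSum t N fun s => b s ω) ξ
      = Complex.exp (-(ξ ^ 2 * expWienerVar t N / 2 : ℝ)) := by
  have hindep := hb.hasIndepIncrements.nat (monotone_gridPoint t N)
  have hindep' : iIndepFun (fun (k : ℕ) ω => Real.exp (gridPoint t N k) *
      (b (gridPoint t N (k + 1)) ω - b (gridPoint t N k) ω)) P :=
    hindep.comp (fun k x => Real.exp (gridPoint t N k) * x) fun k => by fun_prop
  have hmeas : ∀ k, AEMeasurable (fun ω =>
      b (gridPoint t N (k + 1)) ω - b (gridPoint t N k) ω) P := fun k =>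
    (hb.aemeasurable _).sub (hb.aemeasurable _)
  unfold expWienerSum
  rw [(hindep'.restrict (Finset.range N)).charFun_map_fun_finsetSum_eq_prod
    fun k _ => (hmeas k).const_mul _]
  simp only [Finset.prod_apply]
  have hk : ∀ k, charFun (P.map fun ω => Real.exp (gridPoint t N k) *
      (b (gridPoint t N (k + 1)) ω - b (gridPoint t N k) ω)) ξ
      = Complex.exp (-(ξ ^ 2 * (Real.exp (gridPoint t N k) ^ 2 * (t / N)) / 2 : ℝ)) := by
    intro k
    rw [charFun_map_mul_comp (hmeas k), show (fun ω => b (gridPoint t N (k + 1)) ω -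
      b (gridPoint t N k) ω) = b (gridPoint t N (k + 1)) - b (gridPoint t N k) from rfl,
      (hb.hasLaw_sub _ _).map_eq, charFun_gaussianReal]
    have hdist : ((nndist (gridPoint t N (k + 1)).1 (gridPoint t N k).1 : ℝ≥0) : ℝ) = t / N := by
      rw [coe_nndist, Real.dist_eq, NNReal.val_eq_coe, NNReal.val_eq_coe, coe_gridPoint,
        coe_gridPoint]
      push_cast
      rw [← sub_mul, add_sub_cancel_left, one_mul, abs_of_nonneg (by positivity)]
    congr 1
    rw [hdist]
    push_cast
    ring
  simp only [hk]
  rw [← Complex.exp_sum]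
  congr 1
  unfold expWienerVar
  rw [← Complex.ofReal_neg, Finset.mul_sum, Finset.sum_div, ← Finset.sum_neg_distrib]
  push_cast
  rfl

/-! ### Isotropic Gaussian laws and the law of the process -/

/-- The Gaussian law on `ℝⁿ` with mean `m` and covariance matrix `s Iₙ`. -/
noncomputable def isotropicGaussian {n : ℕ} (m : EuclideanSpace ℝ (Fin n)) (s : ℝ) :
    Measure (EuclideanSpace ℝ (Fin n)) :=
  multivariateGaussian m (s • (1 : Matrix (Fin n) (Fin n) ℝ))

instance {n : ℕ} (m : EuclideanSpace ℝ (Fin n)) (s : ℝ) : IsGaussian (isotropicGaussian m s) := by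
  unfold isotropicGaussian
  infer_instance

lemma posSemidef_smul_one (n : ℕ) {s : ℝ} (hs : 0 ≤ s) :
    (s • (1 : Matrix (Fin n) (Fin n) ℝ)).PosSemidef :=
  Matrix.PosSemidef.one.smul hs

lemma charFun_isotropicGaussian {n : ℕ} (m ξ : EuclideanSpace ℝ (Fin n)) {s : ℝ} (hs : 0 ≤ s) :
    charFun (isotropicGaussian m s) ξ
      = Complex.exp ((inner ℝ ξ m : ℝ) * Complex.I - (s * ‖ξ‖ ^ 2 / 2 : ℝ)) := by
  unfold isotropicGaussian
  rw [charFun_multivariateGaussian (posSemidef_smul_one n hs)]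
  congr 2
  rw [Matrix.smul_mulVec, Matrix.one_mulVec, dotProduct_smul, EuclideanSpace.real_norm_sq_eq]
  simp [dotProduct, pow_two]

lemma charFun_map_toLp_expWienerSum {Ω : Type*} [MeasurableSpace Ω] {P : Measure Ω}
    [IsProbabilityMeasure P] {n : ℕ} {B : ℝ≥0 → Ω → EuclideanSpace ℝ (Fin n)}
    (hB : IsStdBrownian B P) (t : ℝ≥0) (N : ℕ) (ξ : EuclideanSpace ℝ (Fin n)) :
    charFun (P.map fun ω => WithLp.toLp 2 fun i => expWienerSum t N fun s => B s ω i) ξ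
      = Complex.exp (-(‖ξ‖ ^ 2 * expWienerVar t N / 2 : ℝ)) := by
  have hmeas : ∀ i, AEMeasurable (fun ω => expWienerSum t N fun s => B s ω i) P := fun i => by
    have := (hB.isBrownianReal i).aemeasurable
    unfold expWienerSum
    fun_prop
  have hindep : iIndepFun (fun i ω => expWienerSum t N fun s => B s ω i) P :=
    hB.iIndepFun.comp (fun _ => expWienerSum t N) fun _ => measurable_expWienerSum t N
  rw [(iIndepFun_iff_charFun_pi hmeas).1 hindep ξ]
  simp_rw [charFun_map_expWienerSum (hB.isBrownianReal _).toIsPreBrownianReal]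
  rw [← Complex.exp_sum]
  congr 1
  rw [EuclideanSpace.real_norm_sq_eq, ← Complex.ofReal_neg, Finset.sum_mul, Finset.sum_div,
    ← Finset.sum_neg_distrib]
  push_cast
  rfl

namespace IsOUProcess

variable {Ω : Type*} [MeasurableSpace Ω] {P : Measure Ω} {n : ℕ} {z₀ : EuclideanSpace ℝ (Fin n)}
  {B Z : ℝ≥0 → Ω → EuclideanSpace ℝ (Fin n)}

/-- The Ornstein-Uhlenbeck process is almost surely a limit of affine functions of Wiener sums. -/
lemma ae_tendsto (hB : IsStdBrownian B P) (hZ : IsOUProcess z₀ B Z P) (t : ℝ≥0) :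
    ∀ᵐ ω ∂P, Tendsto (fun N => Real.exp (-t) • z₀ + (Real.exp (-t) * √(2 / (n : ℝ))) •
      (WithLp.toLp 2 fun i => expWienerSum t N fun s => B s ω i : EuclideanSpace ℝ (Fin n)))
      atTop (𝓝 (Z t ω)) := by
  have hc : ∀ᵐ ω ∂P, ∀ i, Continuous fun s => B s ω i :=
    ae_all_iff.2 fun i => (hB.isBrownianReal i).cont
  have h0 : ∀ᵐ ω ∂P, ∀ i, B 0 ω i = 0 :=
    ae_all_iff.2 fun i => (hB.isBrownianReal i).eval_zero_ae_eq_zero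
  filter_upwards [hc, h0, hZ.continuous, hZ.sde] with ω hc h0 hZc hsde
  have hZr : Continuous fun s : ℝ => Z s.toNNReal ω := hZc.comp continuous_real_toNNReal
  have hkey : ∀ i, Real.exp t * Z t ω i = z₀ i + √(2 / (n : ℝ)) *
      (Real.exp t * B t ω i - ∫ s in (0 : ℝ)..t, B s.toNNReal ω i * Real.exp s) := by
    intro i
    have hZi : Continuous fun s : ℝ => Z s.toNNReal ω i :=
      (EuclideanSpace.proj (𝕜 := ℝ) i).continuous.comp hZr
    have := exp_mul_eq_of_eq_sub_integral (z := fun s => Z s.toNNReal ω i)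
      (w := fun s => √(2 / (n : ℝ)) * B s.toNNReal ω i) (z₀ := z₀ i) hZi (fun s hs => by
        have h1 := (EuclideanSpace.proj (𝕜 := ℝ) i).intervalIntegral_comp_comm
          (hZr.intervalIntegrable (μ := volume) 0 s)
        have h2 := congrArg (fun v : EuclideanSpace ℝ (Fin n) => v i) (hsde s.toNNReal)
        simp only [Real.coe_toNNReal s hs, PiLp.sub_apply, PiLp.add_apply, PiLp.smul_apply,
          smul_eq_mul] at h2
        rw [h2]
        exact congrArg _ h1.symm) t.2
    simp only [NNReal.val_eq_coe, Real.toNNReal_coe, mul_assoc] at this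
    rw [this, intervalIntegral.integral_const_mul]
    ring
  have hlim : Tendsto (fun N => (WithLp.toLp 2 fun i => expWienerSum t N fun s => B s ω i :
      EuclideanSpace ℝ (Fin n))) atTop (𝓝 (WithLp.toLp 2 fun i =>
        Real.exp t * B t ω i - ∫ s in (0 : ℝ)..t, B s.toNNReal ω i * Real.exp s)) :=
    ((PiLp.continuous_toLp 2 _).tendsto _).comp
      (tendsto_pi_nhds.2 fun i => tendsto_expWienerSum (hc i) (h0 i))
  -- The limit of the affine functions is identified coordinatewise by multiplying `hkey` by
  -- `e^{-t}`.
  convert (hlim.const_smul (Real.exp (-t) * √(2 / (n : ℝ)))).const_add (Real.exp (-t) • z₀) using 2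
  ext i
  simp only [PiLp.add_apply, PiLp.smul_apply, smul_eq_mul]
  rw [mul_assoc, ← mul_add, ← hkey i, ← mul_assoc, ← Real.exp_add]
  simp

/-- The law of the Ornstein-Uhlenbeck process at time `t`. -/
theorem map_eq [IsProbabilityMeasure P] (hB : IsStdBrownian B P) (hZ : IsOUProcess z₀ B Z P)
    (t : ℝ≥0) :
    P.map (Z t) = isotropicGaussian (Real.exp (-t) • z₀) ((1 - Real.exp (-2 * t)) / n) := by
  have := Measure.isProbabilityMeasure_map (hZ.aemeasurable t)
  have hs : 0 ≤ (1 - Real.exp (-2 * t)) / n := by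
    have : Real.exp (-2 * t) ≤ 1 := Real.exp_le_one_iff.2 (by simp)
    have := sub_nonneg.2 this
    positivity
  refine Measure.ext_of_charFun (funext fun ξ => ?_)
  rw [charFun_isotropicGaussian _ _ hs]
  set c : ℝ := Real.exp (-t) * √(2 / (n : ℝ)) with hc
  set S : ℕ → Ω → EuclideanSpace ℝ (Fin n) := fun N ω =>
    WithLp.toLp 2 fun i => expWienerSum t N fun s => B s ω i with hS
  have hSm : ∀ N, AEMeasurable (S N) P := fun N => by
    have := fun i => (hB.isBrownianReal i).aemeasurable
    refine (WithLp.measurable_toLp 2 (Fin n → ℝ)).comp_aemeasurable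
      (aemeasurable_pi_lambda _ fun i => ?_)
    unfold expWienerSum
    fun_prop
  have hN : ∀ N, charFun (P.map fun ω => Real.exp (-t) • z₀ + c • S N ω) ξ
      = Complex.exp ((inner ℝ ξ (Real.exp (-t) • z₀) : ℝ) * Complex.I
        - (c ^ 2 * expWienerVar t N * ‖ξ‖ ^ 2 / 2 : ℝ)) := by
    intro N
    have h1 := charFun_map_const_add (μ := P.map fun ω => c • S N ω) (Real.exp (-t) • z₀) ξ
    have hcS : AEMeasurable (fun ω => c • S N ω) P := (hSm N).const_smul c
    rw [AEMeasurable.map_map_of_aemeasurable (by fun_prop) hcS] at h1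
    rw [show (fun ω => Real.exp (-t) • z₀ + c • S N ω)
      = (fun x => Real.exp (-t) • z₀ + x) ∘ fun ω => c • S N ω from rfl, h1,
      charFun_map_smul_comp (hSm N), charFun_map_toLp_expWienerSum hB, ← Complex.exp_add,
      real_inner_comm ξ, norm_smul, mul_pow, Real.norm_eq_abs, sq_abs]
    congr 1
    push_cast
    ring
  have hvar : c ^ 2 * ((Real.exp (2 * t) - 1) / 2) = (1 - Real.exp (-2 * t)) / n := by
    rw [hc, mul_pow, Real.sq_sqrt (by positivity), ← Real.exp_nat_mul]
    have : Real.exp (-2 * t) * Real.exp (2 * t) = 1 := by rw [← Real.exp_add]; simp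
    rw [show ((2 : ℕ) : ℝ) * -(t : ℝ) = -2 * t by push_cast; ring]
    linear_combination (1 / (n : ℝ)) * this
  -- The characteristic functions of the approximations have two limits: one from the explicit
  -- variances, one from almost sure convergence and domination by `1`. Uniqueness of limits
  -- identifies the law.
  have hlim1 : Tendsto (fun N => charFun (P.map fun ω => Real.exp (-t) • z₀ + c • S N ω) ξ) atTop
      (𝓝 (Complex.exp ((inner ℝ ξ (Real.exp (-t) • z₀) : ℝ) * Complex.I
        - ((1 - Real.exp (-2 * t)) / n * ‖ξ‖ ^ 2 / 2 : ℝ)))) := by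
    simp_rw [hN]
    rw [← hvar]
    refine (Complex.continuous_exp.tendsto _).comp (tendsto_const_nhds.sub ?_)
    exact (Complex.continuous_ofReal.tendsto _).comp
      ((((tendsto_expWienerVar t).const_mul _).mul_const _).div_const _)
  have hlim2 : Tendsto (fun N => charFun (P.map fun ω => Real.exp (-t) • z₀ + c • S N ω) ξ) atTop
      (𝓝 (charFun (P.map (Z t)) ξ)) := by
    simp only [charFun_apply]
    have hcont : Continuous fun x : EuclideanSpace ℝ (Fin n) =>
        Complex.exp ((inner ℝ x ξ : ℝ) * Complex.I) := by fun_prop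
    have hXm : ∀ N, AEMeasurable (fun ω => Real.exp (-t) • z₀ + c • S N ω) P := fun N =>
      ((hSm N).const_smul c).const_add _
    rw [integral_map (hZ.aemeasurable t) hcont.aestronglyMeasurable]
    simp_rw [integral_map (hXm _) hcont.aestronglyMeasurable]
    refine tendsto_integral_of_dominated_convergence (fun _ => 1)
      (fun N => hcont.comp_aestronglyMeasurable (hXm N).aestronglyMeasurable)
      (integrable_const _) (fun N => ae_of_all _ fun ω => ?_) ?_
    · rw [Complex.norm_exp_ofReal_mul_I]
    · filter_upwards [ae_tendsto hB hZ t] with ω hω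
      exact (hcont.tendsto _).comp hω
  exact tendsto_nhds_unique hlim2 hlim1

end IsOUProcess

/-! ### Lebesgue density of an isotropic Gaussian -/

section Density

variable {n : ℕ}

lemma integral_exp_neg_mul_norm_sub_sq (c : EuclideanSpace ℝ (Fin n)) {b : ℝ} (hb : 0 < b) :
    ∫ x : EuclideanSpace ℝ (Fin n), Real.exp (-b * ‖x - c‖ ^ 2) = (Real.pi / b) ^ ((n : ℝ) / 2) := by
  rw [integral_sub_right_eq_self (fun x => Real.exp (-b * ‖x‖ ^ 2)) c,
    GaussianFourier.integral_rexp_neg_mul_sq_norm hb]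
  simp

/-- The density of `isotropicGaussian m s` with respect to the Lebesgue measure. -/
noncomputable def isotropicPDF (m : EuclideanSpace ℝ (Fin n)) (s : ℝ)
    (x : EuclideanSpace ℝ (Fin n)) : ℝ :=
  (2 * Real.pi * s) ^ (-((n : ℝ) / 2)) * Real.exp (-(2 * s)⁻¹ * ‖x - m‖ ^ 2)

lemma isotropicPDF_pos (m x : EuclideanSpace ℝ (Fin n)) {s : ℝ} (hs : 0 < s) :
    0 < isotropicPDF m s x := by
  unfold isotropicPDF
  positivity

lemma contDiff_isotropicPDF (m : EuclideanSpace ℝ (Fin n)) (s : ℝ) :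
    ContDiff ℝ (⊤ : ℕ∞) (isotropicPDF m s) := by
  unfold isotropicPDF
  exact contDiff_const.mul (Real.contDiff_exp.comp (contDiff_const.mul
    ((contDiff_id.sub contDiff_const).norm_sq ℝ)))

@[fun_prop]
lemma continuous_isotropicPDF (m : EuclideanSpace ℝ (Fin n)) (s : ℝ) :
    Continuous (isotropicPDF m s) := (contDiff_isotropicPDF m s).continuous

@[fun_prop]
lemma measurable_isotropicPDF (m : EuclideanSpace ℝ (Fin n)) (s : ℝ) :
    Measurable (isotropicPDF m s) := (continuous_isotropicPDF m s).measurable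

lemma integral_isotropicPDF (m : EuclideanSpace ℝ (Fin n)) {s : ℝ} (hs : 0 < s) :
    ∫ x, isotropicPDF m s x = 1 := by
  unfold isotropicPDF
  rw [integral_const_mul, integral_exp_neg_mul_norm_sub_sq _ (by positivity),
    show Real.pi / (2 * s)⁻¹ = 2 * Real.pi * s by field_simp, ← Real.rpow_add (by positivity)]
  simp

/-- The Bochner integral of a non-integrable function is `0` by convention, so a nonzero value
certifies integrability. -/
lemma integrable_isotropicPDF (m : EuclideanSpace ℝ (Fin n)) {s : ℝ} (hs : 0 < s) :
    Integrable (isotropicPDF m s) :=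
  Integrable.of_integral_ne_zero (by rw [integral_isotropicPDF m hs]; exact one_ne_zero)

lemma isotropicGaussian_eq_withDensity (m : EuclideanSpace ℝ (Fin n)) {s : ℝ} (hs : 0 < s) :
    isotropicGaussian m s = volume.withDensity fun x => ENNReal.ofReal (isotropicPDF m s x) := by
  have hfin : IsFiniteMeasure
      (volume.withDensity fun x => ENNReal.ofReal (isotropicPDF m s x)) := by
    refine isFiniteMeasure_withDensity ?_
    rw [← ofReal_integral_eq_lintegral_ofReal (integrable_isotropicPDF m hs)
      (ae_of_all _ fun x => (isotropicPDF_pos m x hs).le)]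
    exact ENNReal.ofReal_ne_top
  refine Measure.ext_of_charFun (funext fun ξ => ?_)
  rw [charFun_isotropicGaussian _ _ hs.le, charFun_apply,
    integral_withDensity_eq_integral_toReal_smul (by fun_prop)
      (ae_of_all _ fun x => ENNReal.ofReal_lt_top)]
  have hb : 0 < ((2 * s)⁻¹ : ℂ).re := by
    rw [show ((2 * s)⁻¹ : ℂ) = (((2 * s)⁻¹ : ℝ) : ℂ) by push_cast; rfl, Complex.ofReal_re]
    positivity
  have hF := GaussianFourier.integral_cexp_neg_mul_sq_norm_add hb Complex.I ξ
  -- Translation by `m` turns the centred Gaussian Fourier integral into the one needed; the shift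
  -- accounts for the phase `e^{i⟨ξ, m⟩}`.
  rw [← integral_sub_right_eq_self _ m] at hF
  have hpt : ∀ x : EuclideanSpace ℝ (Fin n), (ENNReal.ofReal (isotropicPDF m s x)).toReal •
      Complex.exp ((inner ℝ x ξ : ℝ) * Complex.I)
      = (((2 * Real.pi * s) ^ (-((n : ℝ) / 2)) : ℝ) * Complex.exp ((inner ℝ ξ m : ℝ) * Complex.I)) *
        Complex.exp (-(2 * s : ℂ)⁻¹ * (‖x - m‖ : ℂ) ^ 2 + Complex.I * (inner ℝ ξ (x - m) : ℝ)) := by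
    intro x
    rw [ENNReal.toReal_ofReal (isotropicPDF_pos m x hs).le, isotropicPDF, Complex.real_smul]
    generalize (2 * Real.pi * s) ^ (-((n : ℝ) / 2)) = K
    push_cast
    rw [mul_assoc, mul_assoc, ← Complex.exp_add, ← Complex.exp_add, inner_sub_right,
      real_inner_comm ξ x]
    congr 2
    push_cast
    ring
  simp_rw [hpt]
  rw [integral_const_mul, hF]
  have hpow : ((Real.pi : ℂ) / (2 * s : ℂ)⁻¹) ^ ((Module.finrank ℝ (EuclideanSpace ℝ (Fin n)) : ℂ) / 2)
      = (((2 * Real.pi * s) ^ ((n : ℝ) / 2) : ℝ) : ℂ) := by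
    rw [Complex.ofReal_cpow (by positivity), finrank_euclideanSpace_fin]
    push_cast
    congr 1
    rw [div_inv_eq_mul]
    ring
  rw [hpow]
  have h1 : (((2 * Real.pi * s) ^ (-((n : ℝ) / 2)) : ℝ) : ℂ)
      * (((2 * Real.pi * s) ^ ((n : ℝ) / 2) : ℝ) : ℂ) = 1 := by
    rw [← Complex.ofReal_mul, ← Real.rpow_add (by positivity)]
    simp
  rw [show ∀ a b c d : ℂ, a * b * (c * d) = a * c * (b * d) from fun a b c d => by ring, h1,
    one_mul, ← Complex.exp_add]
  congr 1
  rw [Complex.I_sq]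
  have : (s : ℂ) ≠ 0 := by exact_mod_cast hs.ne'
  push_cast
  field_simp
  ring

end Density

/-! ### Second moments of isotropic Gaussians -/

section Moments

variable {n : ℕ} (m : EuclideanSpace ℝ (Fin n)) {s : ℝ}

lemma integrable_norm_sub_sq_isotropicGaussian (c : EuclideanSpace ℝ (Fin n)) :
    Integrable (fun x => ‖x - c‖ ^ 2) (isotropicGaussian m s) :=
  MemLp.integrable_norm_pow (IsGaussian.memLp_two_id.sub (memLp_const c)) two_ne_zero

lemma integral_norm_sub_sq_isotropicGaussian (hs : 0 ≤ s) :
    ∫ x, ‖x - m‖ ^ 2 ∂(isotropicGaussian m s) = n * s := by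
  have hpsd := posSemidef_smul_one n hs
  have hcoord : ∀ i, Integrable (fun x : EuclideanSpace ℝ (Fin n) => (x i - m i) ^ 2)
      (isotropicGaussian m s) := fun i => by
    refine (integrable_norm_sub_sq_isotropicGaussian m m).mono' (by fun_prop)
      (ae_of_all _ fun x => ?_)
    rw [Real.norm_eq_abs, abs_of_nonneg (sq_nonneg _), EuclideanSpace.real_norm_sq_eq]
    exact Finset.single_le_sum (f := fun i => ((x - m) i) ^ 2) (fun j _ => sq_nonneg _)
      (Finset.mem_univ i)
  simp_rw [EuclideanSpace.real_norm_sq_eq, PiLp.sub_apply]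
  rw [integral_finsetSum _ fun i _ => hcoord i]
  have hvar : ∀ i, ∫ x, (x i - m i) ^ 2 ∂(isotropicGaussian m s) = s := fun i => by
    have hmp := measurePreserving_eval_multivariateGaussian (μ := m) hpsd (i := i)
    have hmean : ∫ x, x i ∂(isotropicGaussian m s) = m i := by
      rw [isotropicGaussian, hmp.hasLaw.integral_eq, integral_id_gaussianReal]
    have := variance_eval_multivariateGaussian (μ := m) hpsd i
    rw [variance_eq_integral (by fun_prop)] at this
    change ∫ x, (x i - ∫ x, x i ∂(isotropicGaussian m s)) ^ 2 ∂(isotropicGaussian m s) = _ at this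
    rw [hmean] at this
    rw [this]
    simp
  simp [hvar]

lemma integrable_inner_sub_isotropicGaussian (b c : EuclideanSpace ℝ (Fin n)) :
    Integrable (fun x => inner ℝ (x - c) b) (isotropicGaussian m s) :=
  (IsGaussian.integrable_id.sub (integrable_const c)).inner_const b

lemma integral_inner_sub_isotropicGaussian (b : EuclideanSpace ℝ (Fin n)) :
    ∫ x, inner ℝ (x - m) b ∂(isotropicGaussian m s) = 0 := by
  have hi : Integrable (fun x : EuclideanSpace ℝ (Fin n) => x - m) (isotropicGaussian m s) :=
    IsGaussian.integrable_id.sub (integrable_const m)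
  simp_rw [real_inner_comm b]
  rw [integral_inner hi, integral_sub IsGaussian.integrable_fun_id (integrable_const m)]
  simp [isotropicGaussian]

lemma lintegral_enorm_smul_sub_add_sq_isotropicGaussian (hs : 0 ≤ s) (a : ℝ)
    (b : EuclideanSpace ℝ (Fin n)) :
    ∫⁻ x, ‖a • (x - m) + b‖ₑ ^ 2 ∂(isotropicGaussian m s)
      = ENNReal.ofReal (a ^ 2 * (n * s) + ‖b‖ ^ 2) := by
  have hexp : ∀ x, ‖a • (x - m) + b‖ ^ 2
      = a ^ 2 * ‖x - m‖ ^ 2 + 2 * a * inner ℝ (x - m) b + ‖b‖ ^ 2 := fun x => by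
    rw [norm_add_sq_real, norm_smul, mul_pow, Real.norm_eq_abs, sq_abs, inner_smul_left]
    simp
    ring
  have h1 := (integrable_norm_sub_sq_isotropicGaussian m (s := s) m).const_mul (a ^ 2)
  have h2 := (integrable_inner_sub_isotropicGaussian m (s := s) b m).const_mul (2 * a)
  have h12 : Integrable (fun x => a ^ 2 * ‖x - m‖ ^ 2 + 2 * a * inner ℝ (x - m) b)
    (isotropicGaussian m s) := h1.add h2
  have h123 : Integrable (fun x => a ^ 2 * ‖x - m‖ ^ 2 + 2 * a * inner ℝ (x - m) b + ‖b‖ ^ 2)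
    (isotropicGaussian m s) := h12.add (integrable_const _)
  have hpt : ∀ x, ‖a • (x - m) + b‖ₑ ^ 2 = ENNReal.ofReal
      (a ^ 2 * ‖x - m‖ ^ 2 + 2 * a * inner ℝ (x - m) b + ‖b‖ ^ 2) := fun x => by
    rw [← hexp, ENNReal.ofReal_pow (norm_nonneg _), ofReal_norm]
  simp_rw [hpt]
  rw [← ofReal_integral_eq_lintegral_ofReal h123
    (ae_of_all _ fun x => (sq_nonneg _).trans_eq (hexp x)),
    integral_add h12 (integrable_const _), integral_add h1 h2, integral_const_mul,
    integral_const_mul, integral_norm_sub_sq_isotropicGaussian m hs,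
    integral_inner_sub_isotropicGaussian]
  simp

end Moments

/-! ### Comparison of divergences through a positive density -/

/-- The right side keeps only the positive part of `h`. This turns signed pointwise lower bounds
into bounds on divergences that may be infinite. -/
lemma ofReal_integral_le_lintegral_ofReal {α : Type*} [MeasurableSpace α] {μ : Measure α}
    {h : α → ℝ} (hh : Integrable h μ) :
    ENNReal.ofReal (∫ x, h x ∂μ) ≤ ∫⁻ x, ENNReal.ofReal (h x) ∂μ := by
  rw [integral_eq_lintegral_pos_part_sub_lintegral_neg_part hh]
  exact (ENNReal.ofReal_le_ofReal (sub_le_self _ ENNReal.toReal_nonneg)).trans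
    ENNReal.ofReal_toReal_le

/-- From `log x ≤ x - 1`: `x log x + 1 - x ≤ x (x - 1) + 1 - x = (x - 1)²`. -/
lemma klFun_le_sub_one_sq {x : ℝ} (hx : 0 < x) :
    InformationTheory.klFun x ≤ (x - 1) ^ 2 := by
  rw [InformationTheory.klFun_apply]
  nlinarith [Real.log_le_sub_one_of_pos hx]

/-- A pointwise substitute for Jensen: the bound `log y ≤ y - 1` at `y = 1 / (b √x)`, multiplied by
`2x`. With `b = ∫ √f dν` it integrates to `-2 log b ≤ KL`, with no need for the divergence to be
finite. -/
lemma sub_div_sub_mul_log_le_klFun {x b : ℝ} (hx : 0 < x) (hb : 0 < b) :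
    x - 2 * √x / b - 2 * x * Real.log b + 1 ≤ InformationTheory.klFun x := by
  have hs : 0 < √x := Real.sqrt_pos.2 hx
  have hss : √x * √x = x := Real.mul_self_sqrt hx.le
  have hlog : Real.log x = 2 * Real.log (√x) := by rw [Real.log_sqrt hx.le]; ring
  have h := Real.log_le_sub_one_of_pos (inv_pos.2 (mul_pos hb hs))
  rw [Real.log_inv, Real.log_mul hb.ne' hs.ne'] at h
  have hmul : x * (b * √x)⁻¹ = √x / b := by
    field_simp
    nlinarith
  rw [InformationTheory.klFun_apply, hlog]
  have := mul_le_mul_of_nonneg_left h hx.le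
  rw [mul_sub, hmul] at this
  have e : 2 * √x / b = 2 * (√x / b) := by ring
  rw [e]
  linarith

section Density

variable {E : Type*} [MeasurableSpace E] {ν : Measure E} {f : E → ℝ}

/-- `f` is a positive probability density with respect to `ν`. -/
structure IsPosDensity (f : E → ℝ) (ν : Measure E) : Prop where
  measurable : Measurable f
  pos : ∀ x, 0 < f x
  integral_eq_one : ∫ x, f x ∂ν = 1

/-- The measure with density `f` with respect to `ν`. -/
noncomputable def densityMeasure (f : E → ℝ) (ν : Measure E) : Measure E :=
  ν.withDensity fun x => ENNReal.ofReal (f x)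

lemma densityMeasure_absolutelyContinuous : densityMeasure f ν ≪ ν := withDensity_absolutelyContinuous _ _

namespace IsPosDensity

variable (hf : IsPosDensity f ν)

include hf

lemma integrable : Integrable f ν :=
  Integrable.of_integral_ne_zero (by rw [hf.integral_eq_one]; exact one_ne_zero)

lemma densityMeasure_add :
    densityMeasure f ν + ν = ν.withDensity fun x => ENNReal.ofReal (f x + 1) := by
  have : (fun x => ENNReal.ofReal (f x + 1)) = (fun x => ENNReal.ofReal (f x)) + 1 := by
    ext x
    rw [ENNReal.ofReal_add (hf.pos x).le zero_le_one]
    simp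
  rw [this, withDensity_add_left hf.measurable.ennreal_ofReal, withDensity_one, densityMeasure]

lemma isProbabilityMeasure : IsProbabilityMeasure (densityMeasure f ν) where
  measure_univ := by
    rw [densityMeasure, withDensity_apply _ MeasurableSet.univ, Measure.restrict_univ,
      ← ofReal_integral_eq_lintegral_ofReal hf.integrable (ae_of_all _ fun x => (hf.pos x).le),
      hf.integral_eq_one, ENNReal.ofReal_one]

variable [IsProbabilityMeasure ν]

lemma integrable_sqrt : Integrable (fun x => √(f x)) ν := by
  refine (hf.integrable.add (integrable_const 1)).mono'
    hf.measurable.sqrt.aestronglyMeasurable (ae_of_all _ fun x => ?_)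
  rw [Real.norm_eq_abs, abs_of_nonneg (Real.sqrt_nonneg _)]
  have := Real.sq_sqrt (hf.pos x).le
  simp only [Pi.add_apply]
  nlinarith [sq_nonneg (√(f x) - 1)]

lemma toReal_rnDeriv : (fun x => ((densityMeasure f ν).rnDeriv ν x).toReal) =ᵐ[ν] f := by
  filter_upwards [Measure.rnDeriv_withDensity ν hf.measurable.ennreal_ofReal] with x hx
  rw [densityMeasure, hx, ENNReal.toReal_ofReal (hf.pos x).le]

lemma chiSquare_eq :
    chiSquare (densityMeasure f ν) ν = ∫⁻ x, ENNReal.ofReal ((f x - 1) ^ 2) ∂ν := by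
  rw [chiSquare, if_pos densityMeasure_absolutelyContinuous]
  refine lintegral_congr_ae ?_
  filter_upwards [hf.toReal_rnDeriv] with x hx
  rw [hx]

lemma klDiv_eq : InformationTheory.klDiv (densityMeasure f ν) ν
    = ∫⁻ x, ENNReal.ofReal (InformationTheory.klFun (f x)) ∂ν := by
  have := hf.isProbabilityMeasure
  rw [InformationTheory.klDiv_eq_lintegral_klFun_of_ac densityMeasure_absolutelyContinuous]
  refine lintegral_congr_ae ?_
  filter_upwards [hf.toReal_rnDeriv] with x hx
  rw [hx]

/-- The reference measure `μ + ν` of the Hellinger distance is `(f + 1) ν`, so densities are divided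
by `f + 1`. Used with `g = f` and with `g = 1`. -/
lemma toReal_rnDeriv_add {g : E → ℝ} (hg : Measurable g) (hg0 : ∀ x, 0 ≤ g x) {μ : Measure E}
    (hμ : μ = ν.withDensity fun x => ENNReal.ofReal (g x)) :
    (fun x => (μ.rnDeriv (densityMeasure f ν + ν) x).toReal)
      =ᵐ[densityMeasure f ν + ν] fun x => g x / (f x + 1) := by
  have := hf.isProbabilityMeasure
  have h1 : Measurable fun x => ENNReal.ofReal (f x + 1) :=
    (hf.measurable.add_const 1).ennreal_ofReal
  have h2 : Measurable fun x => ENNReal.ofReal (g x / (f x + 1)) :=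
    (hg.div (hf.measurable.add_const 1)).ennreal_ofReal
  have hμ' : μ = (densityMeasure f ν + ν).withDensity
      fun x => ENNReal.ofReal (g x / (f x + 1)) := by
    rw [hf.densityMeasure_add, ← withDensity_mul _ h1 h2, hμ]
    congr 1 with x
    have := hf.pos x
    rw [Pi.mul_apply, ← ENNReal.ofReal_mul (by linarith)]
    congr 1
    field_simp
  filter_upwards [Measure.rnDeriv_withDensity (densityMeasure f ν + ν) h2] with x hx
  have := hf.pos x
  have := hg0 x
  rw [hμ', hx, ENNReal.toReal_ofReal (by positivity)]

lemma hellinger_eq_lintegral : hellinger (densityMeasure f ν) ν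
    = (∫⁻ x, ENNReal.ofReal (1 / 2 * (√(f x) - 1) ^ 2) ∂ν) ^ (1 / 2 : ℝ) := by
  rw [hellinger]
  congr 1
  have hν : ν = ν.withDensity fun x => ENNReal.ofReal ((fun _ => (1 : ℝ)) x) := by
    simp only [ENNReal.ofReal_one]
    exact withDensity_one.symm
  have h1 := hf.toReal_rnDeriv_add hf.measurable (fun x => (hf.pos x).le) (μ := densityMeasure f ν)
    rfl
  have h2 := hf.toReal_rnDeriv_add measurable_const (fun x => zero_le_one) hν
  calc _ = ∫⁻ x, ENNReal.ofReal (1 / 2 * (√(f x) - 1) ^ 2 / (f x + 1))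
        ∂(densityMeasure f ν + ν) := by
        refine lintegral_congr_ae ?_
        filter_upwards [h1, h2] with x hx1 hx2
        have := hf.pos x
        rw [hx1, hx2, Real.sqrt_div (hf.pos x).le, Real.sqrt_div zero_le_one, Real.sqrt_one,
          ← sub_div, div_pow, Real.sq_sqrt (by linarith), mul_div_assoc]
    _ = _ := by
        have hm : Measurable fun x => ENNReal.ofReal (1 / 2 * (√(f x) - 1) ^ 2 / (f x + 1)) := by
          have := hf.measurable
          fun_prop
        rw [hf.densityMeasure_add, lintegral_withDensity_eq_lintegral_mul _
          (hf.measurable.add_const 1).ennreal_ofReal hm]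
        refine lintegral_congr fun x => ?_
        have := hf.pos x
        rw [Pi.mul_apply, ← ENNReal.ofReal_mul (by linarith)]
        congr 1
        field_simp

lemma hellinger_eq : hellinger (densityMeasure f ν) ν
    = ENNReal.ofReal (1 - ∫ x, √(f x) ∂ν) ^ (1 / 2 : ℝ) := by
  rw [hf.hellinger_eq_lintegral]
  congr 1
  have hpt : ∀ x, 1 / 2 * (√(f x) - 1) ^ 2 = (1 / 2 * f x - √(f x)) + 1 / 2 := fun x => by
    have := Real.sq_sqrt (hf.pos x).le
    linear_combination (1 / 2) * this
  have hi1 := hf.integrable.const_mul (1 / 2)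
  have hi2 : Integrable (fun x => 1 / 2 * f x - √(f x)) ν := hi1.sub hf.integrable_sqrt
  have hi3 : Integrable (fun x => 1 / 2 * (√(f x) - 1) ^ 2) ν := by
    simp_rw [hpt]
    exact hi2.add (integrable_const _)
  rw [← ofReal_integral_eq_lintegral_ofReal hi3 (ae_of_all _ fun x => by positivity)]
  simp_rw [hpt]
  rw [integral_add hi2 (integrable_const _), integral_sub hi1 hf.integrable_sqrt,
    integral_const_mul, hf.integral_eq_one]
  congr 1
  simp
  ring

lemma klDiv_le_chiSquare :
    InformationTheory.klDiv (densityMeasure f ν) ν ≤ chiSquare (densityMeasure f ν) ν := by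
  rw [hf.klDiv_eq, hf.chiSquare_eq]
  exact lintegral_mono fun x => ENNReal.ofReal_le_ofReal (klFun_le_sub_one_sq (hf.pos x))

/-- Pointwise, `(f - 1)² = (√f - 1)² (√f + 1)²` with `√f + 1 ≥ 1`. -/
lemma hellinger_le_chiSquare :
    hellinger (densityMeasure f ν) ν ≤ chiSquare (densityMeasure f ν) ν ^ (1 / 2 : ℝ) := by
  rw [hf.hellinger_eq_lintegral, hf.chiSquare_eq]
  refine ENNReal.rpow_le_rpow (lintegral_mono fun x => ENNReal.ofReal_le_ofReal ?_) (by norm_num)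
  have hx := Real.sq_sqrt (hf.pos x).le
  have hs := Real.sqrt_nonneg (f x)
  have : (f x - 1) ^ 2 = (√(f x) - 1) ^ 2 * (√(f x) + 1) ^ 2 := by rw [← mul_pow]; congr 1; nlinarith
  rw [this, mul_comm]
  exact mul_le_mul_of_nonneg_left (by nlinarith) (sq_nonneg _)

lemma measureReal_sub_eq {A : Set E} (hA : MeasurableSet A) :
    (densityMeasure f ν).real A - ν.real A = ∫ x in A, (f x - 1) ∂ν := by
  rw [integral_sub hf.integrable.integrableOn (integrable_const _).integrableOn]
  congr 1
  · rw [measureReal_def, densityMeasure, withDensity_apply _ hA,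
      ← ofReal_integral_eq_lintegral_ofReal hf.integrable.integrableOn
      (ae_of_all _ fun x => (hf.pos x).le), ENNReal.toReal_ofReal
      (integral_nonneg fun x => (hf.pos x).le)]
  · simp

/-- The difference on any set is at most `∫ |f - 1| dν`, and Cauchy–Schwarz against the constant `1`
concludes. -/
lemma totalVariation_le_chiSquare :
    totalVariation (densityMeasure f ν) ν ≤ chiSquare (densityMeasure f ν) ν ^ (1 / 2 : ℝ) := by
  refine iSup₂_le fun A hA => ?_
  rw [hf.measureReal_sub_eq hA, ← Real.norm_eq_abs, ofReal_norm, hf.chiSquare_eq]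
  refine (enorm_integral_le_lintegral_enorm _).trans ((setLIntegral_le_lintegral _ _).trans ?_)
  have hm : Measurable fun x => ‖f x - 1‖ₑ := (hf.measurable.sub_const 1).enorm
  have := ENNReal.lintegral_mul_le_Lp_mul_Lq ν Real.HolderConjugate.two_two hm.aemeasurable
    (g := 1) aemeasurable_const
  simp only [mul_one, Pi.one_apply, ENNReal.one_rpow, lintegral_one, measure_univ] at this
  refine this.trans_eq ?_
  congr 1
  refine lintegral_congr fun x => ?_
  rw [← ofReal_norm, ENNReal.ofReal_rpow_of_nonneg (norm_nonneg _) zero_le_two, Real.norm_eq_abs,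
    Real.rpow_two, sq_abs]

/-- Test the set `{f ≥ 1}`: there `f - √f ≤ f - 1`, and elsewhere `f - √f ≤ 0`. Integration gives `1
- ∫ √f dν`. -/
lemma ofReal_one_sub_le_totalVariation :
    ENNReal.ofReal (1 - ∫ x, √(f x) ∂ν) ≤ totalVariation (densityMeasure f ν) ν := by
  set A : Set E := {x | 1 ≤ f x} with hA
  have hAm : MeasurableSet A := measurableSet_le measurable_const hf.measurable
  refine le_trans ?_ (le_iSup₂ (f := fun (A : Set E) (_ : MeasurableSet A) =>
    ENNReal.ofReal |(densityMeasure f ν).real A - ν.real A|) A hAm)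
  refine ENNReal.ofReal_le_ofReal (le_trans ?_ (le_abs_self _))
  have hBC : 1 - ∫ x, √(f x) ∂ν = ∫ x, (f x - √(f x)) ∂ν := by
    rw [integral_sub hf.integrable hf.integrable_sqrt, hf.integral_eq_one]
  rw [hf.measureReal_sub_eq hAm, ← integral_indicator hAm, hBC]
  refine integral_mono (hf.integrable.sub hf.integrable_sqrt)
    ((hf.integrable.sub (integrable_const 1)).indicator hAm) fun x => ?_
  have hx := Real.sq_sqrt (hf.pos x).le
  have hs := Real.sqrt_nonneg (f x)
  by_cases hxA : x ∈ A
  · simp only [Set.indicator_of_mem hxA]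
    have : 1 ≤ √(f x) := Real.one_le_sqrt.2 hxA
    linarith
  · simp only [Set.indicator_of_notMem hxA]
    have : √(f x) ≤ 1 := Real.sqrt_le_one.2 (not_le.1 hxA).le
    nlinarith

lemma totalVariation_le_one : totalVariation (densityMeasure f ν) ν ≤ 1 := by
  have := hf.isProbabilityMeasure
  refine iSup₂_le fun A _ => ?_
  rw [← ENNReal.ofReal_one]
  refine ENNReal.ofReal_le_ofReal (abs_le.2 ⟨?_, ?_⟩)
  · linarith [measureReal_le_one (μ := ν) (s := A),
      measureReal_nonneg (μ := densityMeasure f ν) (s := A)]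
  · linarith [measureReal_le_one (μ := densityMeasure f ν) (s := A),
      measureReal_nonneg (μ := ν) (s := A)]

lemma integral_sqrt_pos : 0 < ∫ x, √(f x) ∂ν := by
  rw [integral_pos_iff_support_of_nonneg (fun x => Real.sqrt_nonneg _) hf.integrable_sqrt]
  have : Function.support (fun x => √(f x)) = Set.univ :=
    Set.eq_univ_of_forall fun x => (Real.sqrt_pos.2 (hf.pos x)).ne'
  rw [this, measure_univ]
  exact one_pos

lemma ofReal_neg_log_le_klDiv : ENNReal.ofReal (-2 * Real.log (∫ x, √(f x) ∂ν))
    ≤ InformationTheory.klDiv (densityMeasure f ν) ν := by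
  set b := ∫ x, √(f x) ∂ν with hb
  have hb0 : 0 < b := hf.integral_sqrt_pos
  have h1 : Integrable (fun x => 2 * √(f x) / b) ν := (hf.integrable_sqrt.const_mul 2).div_const b
  have h2 : Integrable (fun x => 2 * f x * Real.log b) ν :=
    (hf.integrable.const_mul 2).mul_const _
  have h3 : Integrable (fun x => f x - 2 * √(f x) / b) ν := hf.integrable.sub h1
  have h4 : Integrable (fun x => f x - 2 * √(f x) / b - 2 * f x * Real.log b) ν := h3.sub h2
  have hint : ∫ x, (f x - 2 * √(f x) / b - 2 * f x * Real.log b + 1) ∂ν = -2 * Real.log b := by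
    rw [integral_add h4 (integrable_const _), integral_sub h3 h2, integral_sub hf.integrable h1,
      integral_div, integral_const_mul, integral_mul_const, integral_const_mul, ← hb,
      hf.integral_eq_one]
    simp
    field_simp
    ring
  rw [← hint, hf.klDiv_eq]
  exact (ofReal_integral_le_lintegral_ofReal (h4.add (integrable_const _))).trans
    (lintegral_mono fun x => ENNReal.ofReal_le_ofReal
      (sub_div_sub_mul_log_le_klFun (hf.pos x) hb0))

end IsPosDensity

end Density

/-! ### Gaussian likelihood ratios: `χ²` and Bhattacharyya coefficient -/

section LikelihoodRatio

variable {n : ℕ} (m : EuclideanSpace ℝ (Fin n)) {s s₀ : ℝ}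

/-- The density of `isotropicGaussian m s` with respect to `isotropicGaussian 0 s₀`. -/
noncomputable def likelihoodRatio (m : EuclideanSpace ℝ (Fin n)) (s s₀ : ℝ)
    (x : EuclideanSpace ℝ (Fin n)) : ℝ :=
  isotropicPDF m s x / isotropicPDF 0 s₀ x

lemma likelihoodRatio_pos (hs : 0 < s) (hs₀ : 0 < s₀) (x : EuclideanSpace ℝ (Fin n)) :
    0 < likelihoodRatio m s s₀ x :=
  div_pos (isotropicPDF_pos m x hs) (isotropicPDF_pos 0 x hs₀)

lemma measurable_likelihoodRatio : Measurable (likelihoodRatio m s s₀) := by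
  unfold likelihoodRatio
  fun_prop

lemma integral_isotropicGaussian_eq (hs : 0 < s) (h : EuclideanSpace ℝ (Fin n) → ℝ) :
    ∫ x, h x ∂(isotropicGaussian m s) = ∫ x, isotropicPDF m s x * h x := by
  rw [isotropicGaussian_eq_withDensity m hs,
    integral_withDensity_eq_integral_toReal_smul (by fun_prop)
      (ae_of_all _ fun x => ENNReal.ofReal_lt_top)]
  refine integral_congr_ae (ae_of_all _ fun x => ?_)
  simp only
  rw [ENNReal.toReal_ofReal (isotropicPDF_pos m x hs).le, smul_eq_mul]

lemma isPosDensity_likelihoodRatio (hs : 0 < s) (hs₀ : 0 < s₀) :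
    IsPosDensity (likelihoodRatio m s s₀) (isotropicGaussian 0 s₀) where
  measurable := measurable_likelihoodRatio m
  pos := likelihoodRatio_pos m hs hs₀
  integral_eq_one := by
    rw [integral_isotropicGaussian_eq _ hs₀, ← integral_isotropicPDF m hs]
    refine integral_congr_ae (ae_of_all _ fun x => ?_)
    exact mul_div_cancel₀ _ (isotropicPDF_pos 0 x hs₀).ne'

lemma densityMeasure_likelihoodRatio (hs : 0 < s) (hs₀ : 0 < s₀) :
    densityMeasure (likelihoodRatio m s s₀) (isotropicGaussian 0 s₀) = isotropicGaussian m s := by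
  have h1 : Measurable fun x => ENNReal.ofReal (isotropicPDF (0 : EuclideanSpace ℝ (Fin n)) s₀ x) :=
    by fun_prop
  rw [densityMeasure, isotropicGaussian_eq_withDensity _ hs₀,
    ← withDensity_mul _ h1 (measurable_likelihoodRatio m).ennreal_ofReal,
    isotropicGaussian_eq_withDensity _ hs]
  congr 1 with x
  rw [Pi.mul_apply, ← ENNReal.ofReal_mul (isotropicPDF_pos 0 x hs₀).le]
  congr 1
  exact mul_div_cancel₀ _ (isotropicPDF_pos 0 x hs₀).ne'

/-- The Hellinger-type integrals of two isotropic Gaussian laws. -/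
lemma integral_likelihoodRatio_rpow (hs : 0 < s) (hs₀ : 0 < s₀) {p D : ℝ}
    (hD : D = p / s + (1 - p) / s₀) (hDpos : 0 < D) :
    ∫ x, likelihoodRatio m s s₀ x ^ p ∂(isotropicGaussian 0 s₀)
      = (s ^ (-p) * s₀ ^ (-(1 - p)) / D) ^ ((n : ℝ) / 2)
        * Real.exp (-(p * (1 - p) * ‖m‖ ^ 2 / (2 * s * s₀ * D))) := by
  have hpi := Real.pi_pos
  -- Completing the square in `f^p` times the reference density: `D` is the resulting precision and
  -- `c` the resulting centre.
  set c : EuclideanSpace ℝ (Fin n) := (p / (s * D)) • m with hc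
  have hquad : ∀ x : EuclideanSpace ℝ (Fin n),
      -(2 * s)⁻¹ * ‖x - m‖ ^ 2 * p + -(2 * s₀)⁻¹ * ‖x - 0‖ ^ 2 * (1 - p)
      = -(D / 2) * ‖x - c‖ ^ 2 + -(p * (1 - p) * ‖m‖ ^ 2 / (2 * s * s₀ * D)) := fun x => by
    rw [sub_zero, norm_sub_sq_real x m, norm_sub_sq_real x c, hc, inner_smul_right, norm_smul,
      mul_pow, Real.norm_eq_abs, sq_abs]
    have hDe : D * (s * s₀) = p * s₀ + (1 - p) * s := by rw [hD]; field_simp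
    have hD0 := hDpos.ne'
    field_simp
    linear_combination ((D * s * ‖x‖ ^ 2) - p * ‖m‖ ^ 2) * hDe
  have hpt : ∀ x, isotropicPDF 0 s₀ x * likelihoodRatio m s s₀ x ^ p
      = ((2 * Real.pi * s) ^ (-((n : ℝ) / 2) * p) * (2 * Real.pi * s₀) ^ (-((n : ℝ) / 2) * (1 - p))
        * Real.exp (-(p * (1 - p) * ‖m‖ ^ 2 / (2 * s * s₀ * D))))
        * Real.exp (-(D / 2) * ‖x - c‖ ^ 2) := fun x => by
    have h0 := isotropicPDF_pos (0 : EuclideanSpace ℝ (Fin n)) x hs₀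
    have h1 := isotropicPDF_pos m x hs
    have hstep : isotropicPDF 0 s₀ x * likelihoodRatio m s s₀ x ^ p
        = isotropicPDF m s x ^ p * isotropicPDF 0 s₀ x ^ (1 - p) := by
      rw [likelihoodRatio, Real.div_rpow h1.le h0.le, Real.rpow_sub h0, Real.rpow_one]
      field_simp
    have hA : 0 < 2 * Real.pi * s := by positivity
    have hA₀ : 0 < 2 * Real.pi * s₀ := by positivity
    rw [hstep, isotropicPDF, isotropicPDF]
    generalize 2 * Real.pi * s = A at hA ⊢
    generalize 2 * Real.pi * s₀ = A₀ at hA₀ ⊢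
    rw [Real.mul_rpow (by positivity) (by positivity),
      Real.mul_rpow (by positivity) (by positivity), ← Real.rpow_mul (by positivity),
      ← Real.rpow_mul (by positivity), ← Real.exp_mul, ← Real.exp_mul,
      mul_mul_mul_comm, ← Real.exp_add, hquad, Real.exp_add]
    ring
  rw [integral_isotropicGaussian_eq _ hs₀]
  simp_rw [hpt]
  rw [integral_const_mul, integral_exp_neg_mul_norm_sub_sq c (by positivity)]
  rw [mul_right_comm]
  congr 1
  rw [show -((n : ℝ) / 2) * p = -p * ((n : ℝ) / 2) by ring,
    show -((n : ℝ) / 2) * (1 - p) = -(1 - p) * ((n : ℝ) / 2) by ring,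
    Real.rpow_mul (by positivity), Real.rpow_mul (by positivity),
    ← Real.mul_rpow (by positivity) (by positivity),
    ← Real.mul_rpow (by positivity) (by positivity)]
  congr 1
  rw [Real.mul_rpow (by positivity) hs.le, Real.mul_rpow (by positivity) hs₀.le]
  have h2pi : (2 * Real.pi) ^ (-p) * (2 * Real.pi) ^ (-(1 - p)) = (2 * Real.pi)⁻¹ := by
    rw [← Real.rpow_add (by positivity), ← Real.rpow_neg_one]
    congr 1
    ring
  calc _ = ((2 * Real.pi) ^ (-p) * (2 * Real.pi) ^ (-(1 - p))) *
        (s ^ (-p) * s₀ ^ (-(1 - p))) * (Real.pi / (D / 2)) := by ring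
    _ = _ := by
        rw [h2pi]
        field_simp

/-- The `χ²` divergence of isotropic Gaussian laws, in terms of `s = s₀ (1 - a)`. -/
lemma chiSquare_isotropicGaussian {a : ℝ} (ha : 0 ≤ a) (ha1 : a < 1) (hs₀ : 0 < s₀) :
    chiSquare (isotropicGaussian m (s₀ * (1 - a))) (isotropicGaussian 0 s₀)
      = ENNReal.ofReal ((1 - a ^ 2) ^ (-((n : ℝ) / 2)) *
        Real.exp (‖m‖ ^ 2 / (s₀ * (1 + a))) - 1) := by
  have h1a : 0 < 1 - a := by linarith
  have hs : 0 < s₀ * (1 - a) := by positivity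
  set f := likelihoodRatio m (s₀ * (1 - a)) s₀ with hfdef
  have hf := isPosDensity_likelihoodRatio m hs hs₀
  have hsq : ∫ x, f x ^ 2 ∂(isotropicGaussian 0 s₀)
      = (1 - a ^ 2) ^ (-((n : ℝ) / 2)) * Real.exp (‖m‖ ^ 2 / (s₀ * (1 + a))) := by
    -- Here `D = 2/s - 1/s₀`, positive because `a ≥ 0`.
    have h := integral_likelihoodRatio_rpow m hs hs₀ (p := 2)
      (D := (1 + a) / (s₀ * (1 - a))) (by field_simp; ring) (by positivity)
    simp_rw [Real.rpow_two] at h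
    rw [h]
    congr 1
    · have hinv : (1 - a ^ 2) ^ (-((n : ℝ) / 2)) = (1 - a ^ 2)⁻¹ ^ ((n : ℝ) / 2) := by
        rw [Real.rpow_neg (by nlinarith), ← Real.inv_rpow (by nlinarith)]
      rw [hinv]
      congr 1
      rw [show (-(1 - 2) : ℝ) = 1 by norm_num, Real.rpow_one, Real.rpow_neg hs.le, Real.rpow_two,
        show 1 - a ^ 2 = (1 - a) * (1 + a) by ring]
      field_simp
    · congr 1
      field_simp
      ring
  have hsqi : Integrable (fun x => f x ^ 2) (isotropicGaussian 0 s₀) :=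
    Integrable.of_integral_ne_zero (by
      rw [hsq]
      have : 0 < 1 - a ^ 2 := by nlinarith
      positivity)
  have hpt : ∀ x, (f x - 1) ^ 2 = f x ^ 2 - 2 * f x + 1 := fun x => by ring
  have hi2 : Integrable (fun x => f x ^ 2 - 2 * f x) (isotropicGaussian 0 s₀) :=
    hsqi.sub (hf.integrable.const_mul 2)
  have hi3 : Integrable (fun x => (f x - 1) ^ 2) (isotropicGaussian 0 s₀) := by
    simp_rw [hpt]
    exact hi2.add (integrable_const _)
  rw [← densityMeasure_likelihoodRatio m hs hs₀, hf.chiSquare_eq,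
    ← ofReal_integral_eq_lintegral_ofReal hi3 (ae_of_all _ fun x => sq_nonneg _)]
  simp_rw [hpt]
  rw [integral_add hi2 (integrable_const _), integral_sub hsqi (hf.integrable.const_mul 2), hsq,
    integral_const_mul, hf.integral_eq_one]
  congr 1
  simp
  ring

/-- The Bhattacharyya coefficient of isotropic Gaussian laws, in terms of `s = s₀ (1 - a)`. -/
lemma integral_sqrt_likelihoodRatio {a : ℝ} (ha1 : a < 1) (hs₀ : 0 < s₀) :
    ∫ x, √(likelihoodRatio m (s₀ * (1 - a)) s₀ x) ∂(isotropicGaussian 0 s₀)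
      = (2 * √(1 - a) / (2 - a)) ^ ((n : ℝ) / 2) *
        Real.exp (-(‖m‖ ^ 2 / (4 * s₀ * (2 - a)))) := by
  have h1a : 0 < 1 - a := by linarith
  have h2a : 0 < 2 - a := by linarith
  have hs : 0 < s₀ * (1 - a) := by positivity
  have h := integral_likelihoodRatio_rpow m hs hs₀ (p := 1 / 2)
    (D := (2 - a) / (2 * (s₀ * (1 - a)))) (by field_simp; ring) (by positivity)
  simp_rw [← Real.sqrt_eq_rpow] at h
  rw [h]
  congr 1
  · congr 1
    rw [show (-(1 - 1 / 2) : ℝ) = -(1 / 2) by norm_num, Real.rpow_neg hs.le, Real.rpow_neg hs₀.le,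
      ← Real.sqrt_eq_rpow, ← Real.sqrt_eq_rpow, Real.sqrt_mul hs₀.le]
    have e1 := Real.mul_self_sqrt hs₀.le
    have e2 := Real.mul_self_sqrt h1a.le
    have p1 := Real.sqrt_pos.2 hs₀
    have p2 := Real.sqrt_pos.2 h1a
    field_simp
    rw [pow_two, pow_two, e1, e2]
    ring
  · congr 1
    field_simp
    ring

/-- For `0 ≤ x ≤ 1/2`, `log (1 - x) ≥ 1 - 1/(1 - x) ≥ -2x`. With `x = a²` the determinant factor is
at most `e^{n a²}`, and `1 + a ≥ 1` handles the mean. -/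
lemma chiSquare_isotropicGaussian_le {a : ℝ} (ha : 0 ≤ a) (ha1 : a ^ 2 ≤ 1 / 2) (hs₀ : 0 < s₀) :
    chiSquare (isotropicGaussian m (s₀ * (1 - a))) (isotropicGaussian 0 s₀)
      ≤ ENNReal.ofReal (Real.exp (n * a ^ 2 + ‖m‖ ^ 2 / s₀) - 1) := by
  rw [chiSquare_isotropicGaussian m ha (by nlinarith) hs₀]
  refine ENNReal.ofReal_le_ofReal (sub_le_sub_right ?_ 1)
  rw [Real.exp_add]
  have h1 : 0 < 1 - a ^ 2 := by linarith
  refine mul_le_mul ?_ (Real.exp_le_exp.2 ?_) (by positivity) (by positivity)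
  · rw [Real.rpow_def_of_pos h1, Real.exp_le_exp]
    have hlog := Real.one_sub_inv_le_log_of_pos h1
    have : -(2 * a ^ 2) ≤ Real.log (1 - a ^ 2) := by
      refine le_trans ?_ hlog
      have : (1 - a ^ 2)⁻¹ ≤ 1 + 2 * a ^ 2 := by
        rw [inv_le_iff_one_le_mul₀ h1]
        nlinarith [sq_nonneg a]
      linarith
    have hn : (0 : ℝ) ≤ n := Nat.cast_nonneg n
    nlinarith
  · gcongr
    nlinarith

/-- The square of the base is `4(1 - a)/(2 - a)² = 1 - a²/(2 - a)² ≤ 1 - a²/4`, so its logarithm is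
at most `-a²/8`, and the power `n/2` yields `n a²/16`. The mean term has room to spare, since `4(2 -
a) ≤ 16`. -/
lemma integral_sqrt_likelihoodRatio_le {a : ℝ} (ha : 0 ≤ a) (ha1 : a < 1) (hs₀ : 0 < s₀) :
    ∫ x, √(likelihoodRatio m (s₀ * (1 - a)) s₀ x) ∂(isotropicGaussian 0 s₀)
      ≤ Real.exp (-(n * a ^ 2 + ‖m‖ ^ 2 / s₀) / 16) := by
  rw [integral_sqrt_likelihoodRatio m ha1 hs₀]
  have h1a : 0 < 1 - a := by linarith
  have h2a : 0 < 2 - a := by linarith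
  have hbase : 0 < 2 * √(1 - a) / (2 - a) := by
    have := Real.sqrt_pos.2 h1a
    positivity
  rw [show -(n * a ^ 2 + ‖m‖ ^ 2 / s₀) / 16 = -(n * a ^ 2) / 16 + -(‖m‖ ^ 2 / s₀ / 16) by ring,
    Real.exp_add]
  refine mul_le_mul ?_ (Real.exp_le_exp.2 (neg_le_neg ?_)) (by positivity) (by positivity)
  · rw [Real.rpow_def_of_pos hbase, Real.exp_le_exp]
    have hlog : Real.log (2 * √(1 - a) / (2 - a)) ≤ -(a ^ 2 / 8) := by
      have h2 : 2 * Real.log (2 * √(1 - a) / (2 - a)) ≤ -(a ^ 2 / 4) := by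
        have : 2 * Real.log (2 * √(1 - a) / (2 - a))
            = Real.log ((2 * √(1 - a) / (2 - a)) ^ 2) := by rw [Real.log_pow]; norm_num
        rw [this]
        refine (Real.log_le_sub_one_of_pos (by positivity)).trans ?_
        rw [div_pow, mul_pow, Real.sq_sqrt h1a.le, sub_le_iff_le_add, div_le_iff₀ (by positivity)]
        nlinarith [mul_nonneg (mul_nonneg ha ha) (mul_nonneg ha (by linarith : 0 ≤ 4 - a))]
      linarith
    have hn : (0 : ℝ) ≤ n := Nat.cast_nonneg n
    nlinarith
  · rw [div_div]
    exact div_le_div_of_nonneg_left (by positivity) (by positivity) (by nlinarith)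

end LikelihoodRatio

/-! ### Weak gradients -/

section WeakGradient

variable {n : ℕ} {u u' : EuclideanSpace ℝ (Fin n) → ℝ}
  {G G' : EuclideanSpace ℝ (Fin n) → EuclideanSpace ℝ (Fin n)}

/-- Integration by parts; compact support of the test function gives all the integrability. -/
lemma isWeakGradient_of_hasFDerivAt (hu : ∀ x, HasFDerivAt u (innerSL ℝ (G x)) x)
    (hG : Continuous G) : IsWeakGradient u G where
  locallyIntegrable := (continuous_iff_continuousAt.2 fun x =>
    (hu x).continuousAt).locallyIntegrable
  locallyIntegrable_grad := hG.locallyIntegrable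
  integral_eq φ hφ hφc v := by
    have huc : Continuous u := continuous_iff_continuousAt.2 fun x => (hu x).continuousAt
    have hfd : ∀ x, fderiv ℝ u x v = inner ℝ (G x) v := fun x => by
      rw [(hu x).fderiv, innerSL_apply_apply]
    have hGv : Continuous fun x => inner ℝ (G x) v := hG.inner continuous_const
    have hφ' : Continuous fun x => fderiv ℝ φ x v :=
      (hφ.continuous_fderiv (by simp)).clm_apply continuous_const
    have h := integral_mul_fderiv_eq_neg_fderiv_mul_of_integrable (μ := volume) (f := u) (g := φ)
      (v := v) ?_ ?_ ?_ (fun x _ => (hu x).differentiableAt)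
      (fun x _ => hφ.differentiable (by simp) x)
    · rw [h]
      congr 1
      refine integral_congr_ae (ae_of_all _ fun x => ?_)
      simp only
      rw [hfd, mul_comm]
    · simp_rw [hfd]
      exact (hGv.mul hφ.continuous).integrable_of_hasCompactSupport hφc.mul_left
    · exact (huc.mul hφ').integrable_of_hasCompactSupport (hφc.fderiv_apply ℝ v).mul_left
    · exact (huc.mul hφ.continuous).integrable_of_hasCompactSupport hφc.mul_left

lemma IsWeakGradient.congr (h : IsWeakGradient u G) (huu' : u =ᵐ[volume] u') :
    IsWeakGradient u' G where
  locallyIntegrable := h.locallyIntegrable.congr huu'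
  locallyIntegrable_grad := h.locallyIntegrable_grad
  integral_eq φ hφ hφc v := by
    rw [← h.integral_eq φ hφ hφc v]
    refine integral_congr_ae ?_
    filter_upwards [huu'] with x hx
    rw [hx]

/-- Fundamental lemma of the calculus of variations, tested against each direction `v`. -/
lemma IsWeakGradient.ae_eq (h : IsWeakGradient u G) (h' : IsWeakGradient u G') :
    G =ᵐ[volume] G' := by
  refine ae_eq_of_integral_contDiff_smul_eq h.locallyIntegrable_grad h'.locallyIntegrable_grad
    fun φ hφ hφc => ext_inner_left ℝ fun v => ?_
  have hi := h.locallyIntegrable_grad.integrable_smul_left_of_hasCompactSupport hφ.continuous hφc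
  have hi' := h'.locallyIntegrable_grad.integrable_smul_left_of_hasCompactSupport hφ.continuous hφc
  rw [← integral_inner hi, ← integral_inner hi']
  have := (h.integral_eq φ hφ hφc v).symm.trans (h'.integral_eq φ hφ hφc v)
  simpa only [inner_smul_right, real_inner_comm, neg_inj] using this

end WeakGradient

/-! ### Fisher information of isotropic Gaussians -/

section Fisher

variable {n : ℕ} (m : EuclideanSpace ℝ (Fin n)) {s s₀ : ℝ}

lemma hasFDerivAt_sqrt_likelihoodRatio (hs : 0 < s) (hs₀ : 0 < s₀)
    (x : EuclideanSpace ℝ (Fin n)) :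
    HasFDerivAt (fun x => √(likelihoodRatio m s s₀ x)) (innerSL ℝ
      ((√(likelihoodRatio m s s₀ x) / 2) • ((s₀⁻¹ - s⁻¹) • (x - m) + s₀⁻¹ • m))) x := by
  set K : ℝ := (2 * Real.pi * s) ^ (-((n : ℝ) / 2)) / (2 * Real.pi * s₀) ^ (-((n : ℝ) / 2))
  have heq : ∀ x, √(likelihoodRatio m s s₀ x)
      = √K * Real.exp (-(4 * s)⁻¹ * ‖x - m‖ ^ 2 + (4 * s₀)⁻¹ * ‖x‖ ^ 2) := fun x => by
    have h1 : likelihoodRatio m s s₀ x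
        = K * Real.exp (-(2 * s)⁻¹ * ‖x - m‖ ^ 2 + (2 * s₀)⁻¹ * ‖x‖ ^ 2) := by
      rw [likelihoodRatio, isotropicPDF, isotropicPDF, mul_div_mul_comm, ← Real.exp_sub, sub_zero]
      congr 2
      ring
    rw [h1, Real.sqrt_mul (by positivity), ← Real.exp_half]
    congr 2
    field_simp
    ring
  simp_rw [heq]
  have h1 := ((hasFDerivAt_id x).sub_const m).norm_sq.const_mul (-(4 * s)⁻¹)
  have h2 := (hasFDerivAt_id x).norm_sq.const_mul (4 * s₀)⁻¹
  refine (((h1.add h2).exp).const_mul (√K)).congr_fderiv ?_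
  ext v
  simp
  ring

/-- The classical gradient `G = (√f / 2) ∇ log f` is a weak gradient, and uniqueness reduces the
infimum to its value. Since `4 |G|² = f |∇ log f|²` and `∇ log f = L` is affine, a second moment
under the law `f ν` remains. -/
lemma fisher_isotropicGaussian (hs : 0 < s) (hs₀ : 0 < s₀) :
    fisher (isotropicGaussian m s) (isotropicGaussian 0 s₀)
      = ENNReal.ofReal ((s₀⁻¹ - s⁻¹) ^ 2 * (n * s) + ‖s₀⁻¹ • m‖ ^ 2) := by
  rw [← lintegral_enorm_smul_sub_add_sq_isotropicGaussian m hs.le]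
  set ν : Measure (EuclideanSpace ℝ (Fin n)) := isotropicGaussian 0 s₀
  set f := likelihoodRatio m s s₀ with hfdef
  have hf : IsPosDensity f ν := isPosDensity_likelihoodRatio m hs hs₀
  set L : EuclideanSpace ℝ (Fin n) → EuclideanSpace ℝ (Fin n) :=
    fun x => (s₀⁻¹ - s⁻¹) • (x - m) + s₀⁻¹ • m
  set G : EuclideanSpace ℝ (Fin n) → EuclideanSpace ℝ (Fin n) := fun x => (√(f x) / 2) • L x
  have hν : ν = volume.withDensity fun x => ENNReal.ofReal (isotropicPDF 0 s₀ x) :=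
    isotropicGaussian_eq_withDensity 0 hs₀
  have hac : ν ≪ volume := hν ▸ withDensity_absolutelyContinuous _ _
  -- The Radon–Nikodym derivative is known only `ν`-a.e., whereas weak gradients refer to Lebesgue
  -- measure.
  have hac' : volume ≪ ν := by
    rw [hν]
    refine withDensity_absolutelyContinuous' (by fun_prop) (ae_of_all _ fun x => ?_)
    exact (ENNReal.ofReal_pos.2 (isotropicPDF_pos 0 x hs₀)).ne'
  have hGd : ∀ x, HasFDerivAt (fun x => √(f x)) (innerSL ℝ (G x)) x :=
    hasFDerivAt_sqrt_likelihoodRatio m hs hs₀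
  have hGc : Continuous G := by
    have : Continuous fun x => √(f x) :=
      continuous_iff_continuousAt.2 fun x => (hGd x).continuousAt
    fun_prop
  have hsqrt : (fun x => √(f x)) =ᵐ[volume]
      fun x => √((densityMeasure f ν).rnDeriv ν x).toReal := by
    filter_upwards [hac'.ae_le hf.toReal_rnDeriv] with x hx
    rw [hx]
  have hG : IsWeakGradient (fun x => √((densityMeasure f ν).rnDeriv ν x).toReal) G :=
    (isWeakGradient_of_hasFDerivAt hGd hGc).congr hsqrt
  have hval : 4 * ∫⁻ x, ‖G x‖ₑ ^ 2 ∂ν = ∫⁻ x, ‖L x‖ₑ ^ 2 ∂(densityMeasure f ν) := by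
    have hLm : Measurable fun x => ‖L x‖ₑ ^ 2 := by fun_prop
    have hGm : Measurable fun x => ‖G x‖ₑ ^ 2 := by fun_prop
    rw [densityMeasure, lintegral_withDensity_eq_lintegral_mul _ hf.measurable.ennreal_ofReal hLm,
      ← lintegral_const_mul _ hGm]
    refine lintegral_congr fun x => ?_
    have hx := (hf.pos x).le
    rw [Pi.mul_apply, ← ofReal_norm, ← ofReal_norm, ← ENNReal.ofReal_pow (norm_nonneg _),
      ← ENNReal.ofReal_pow (norm_nonneg _), ← ENNReal.ofReal_mul hx,
      show (4 : ℝ≥0∞) = ENNReal.ofReal 4 by simp, ← ENNReal.ofReal_mul (by norm_num)]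
    congr 1
    rw [norm_smul, mul_pow, Real.norm_eq_abs, sq_abs, div_pow, Real.sq_sqrt hx]
    ring
  rw [← densityMeasure_likelihoodRatio m hs hs₀, fisher, if_pos densityMeasure_absolutelyContinuous,
    ← hval]
  refine le_antisymm (iInf₂_le G hG) (le_iInf₂ fun G' hG' => ?_)
  refine mul_le_mul_right (lintegral_mono_ae ?_) _
  filter_upwards [hac.ae_le (hG.ae_eq hG')] with x hx
  rw [hx]

lemma fisher_isotropicGaussian_mul_one_sub {a : ℝ} (ha1 : a < 1) (hs₀ : 0 < s₀) :
    fisher (isotropicGaussian m (s₀ * (1 - a))) (isotropicGaussian 0 s₀)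
      = ENNReal.ofReal (n * a ^ 2 / ((1 - a) * s₀) + ‖m‖ ^ 2 / s₀ ^ 2) := by
  have h1a : 0 < 1 - a := by linarith
  rw [fisher_isotropicGaussian m (by positivity) hs₀, norm_smul, mul_pow, Real.norm_eq_abs, sq_abs]
  congr 1
  field_simp
  ring

end Fisher

/-! ### Wasserstein distance between isotropic Gaussians -/

section Wasserstein

variable {n : ℕ} (m : EuclideanSpace ℝ (Fin n)) {s s₀ : ℝ}

lemma map_stdGaussian_eq_isotropicGaussian (hs : 0 ≤ s) :
    (stdGaussian (EuclideanSpace ℝ (Fin n))).map (fun x => m + √s • x) = isotropicGaussian m s := by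
  have := Measure.isProbabilityMeasure_map (μ := stdGaussian (EuclideanSpace ℝ (Fin n)))
    (f := fun x => m + √s • x) (by fun_prop)
  refine Measure.ext_of_charFun (funext fun ξ => ?_)
  rw [charFun_isotropicGaussian _ _ hs, show (fun x => m + √s • x) = (m + ·) ∘ (√s • ·) from rfl,
    ← Measure.map_map (by fun_prop) (by fun_prop), charFun_map_const_add, charFun_map_smul,
    charFun_stdGaussian, ← Complex.exp_add, norm_smul, Real.norm_eq_abs,
    abs_of_nonneg (Real.sqrt_nonneg s), real_inner_comm ξ m]
  congr 1
  push_cast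
  rw [mul_pow, ← Complex.ofReal_pow (√s), Real.sq_sqrt hs]
  ring

lemma wasserstein_sq {E : Type*} [MeasurableSpace E] [PseudoEMetricSpace E] (μ ν : Measure E) :
    wasserstein μ ν ^ 2 = ⨅ (π : Measure (E × E)) (_ : π.map Prod.fst = μ ∧ π.map Prod.snd = ν),
      ∫⁻ p, edist p.1 p.2 ^ 2 ∂π := by
  rw [wasserstein, ← ENNReal.rpow_natCast, ← ENNReal.rpow_mul]
  norm_num

/-- Couple through one standard Gaussian `ξ`: `X = m + √s ξ`, `Y = √s₀ ξ`. -/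
lemma wasserstein_sq_isotropicGaussian_le (hs : 0 ≤ s) (hs₀ : 0 ≤ s₀) :
    wasserstein (isotropicGaussian m s) (isotropicGaussian 0 s₀) ^ 2
      ≤ ENNReal.ofReal (‖m‖ ^ 2 + n * (√s - √s₀) ^ 2) := by
  rw [wasserstein_sq]
  set γ := stdGaussian (EuclideanSpace ℝ (Fin n)) with hγ
  refine (iInf₂_le (γ.map fun x => (m + √s • x, (0 : EuclideanSpace ℝ (Fin n)) + √s₀ • x))
    ⟨?_, ?_⟩).trans_eq ?_
  rotate_left
  · rw [Measure.map_map (by fun_prop) (by fun_prop)]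
    exact map_stdGaussian_eq_isotropicGaussian m hs
  · rw [Measure.map_map (by fun_prop) (by fun_prop)]
    exact map_stdGaussian_eq_isotropicGaussian 0 hs₀
  · rw [lintegral_map (by fun_prop) (by fun_prop)]
    have h := lintegral_enorm_smul_sub_add_sq_isotropicGaussian
      (0 : EuclideanSpace ℝ (Fin n)) zero_le_one (√s - √s₀) m
    rw [isotropicGaussian, one_smul, multivariateGaussian_zero_one] at h
    rw [show ‖m‖ ^ 2 + n * (√s - √s₀) ^ 2 = (√s - √s₀) ^ 2 * (n * 1) + ‖m‖ ^ 2 by ring, ← h]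
    refine lintegral_congr fun x => ?_
    rw [edist_eq_enorm_sub]
    congr 2
    simp only [zero_add, sub_zero, sub_smul]
    abel

/-- Kantorovich duality with quadratic potentials: the left side is a function of `x` plus a
function of `y`, so its integral is the same for every coupling. Beyond algebra it is Young's
inequality `2⟨x - m, y⟩ ≤ c |x - m|² + c⁻¹ |y|²`. -/
lemma one_sub_mul_norm_sq_le {E : Type*} [NormedAddCommGroup E] [InnerProductSpace ℝ E] (x y m : E)
    {c : ℝ} (hc : 0 < c) :
    ‖m‖ ^ 2 + 2 * inner ℝ (x - m) m - 2 * inner ℝ y m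
      + (1 - c) * ‖x - m‖ ^ 2 + (1 - c⁻¹) * ‖y‖ ^ 2 ≤ ‖x - y‖ ^ 2 := by
  have h1 : ‖x - y‖ ^ 2 = ‖m‖ ^ 2 + 2 * inner ℝ (x - m) m - 2 * inner ℝ y m
      + ‖(x - m) - y‖ ^ 2 := by
    rw [show x - y = m + ((x - m) - y) by abel, norm_add_sq_real, inner_sub_right,
      real_inner_comm (x - m), real_inner_comm y]
    ring
  have h2 := norm_sub_sq_real (x - m) y
  have h3 : 0 ≤ ‖c • (x - m) - y‖ ^ 2 := by positivity
  rw [norm_sub_sq_real, norm_smul, mul_pow, Real.norm_eq_abs, sq_abs, inner_smul_left] at h3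
  simp only [conj_trivial] at h3
  have h4 : 2 * inner ℝ (x - m) y ≤ c * ‖x - m‖ ^ 2 + c⁻¹ * ‖y‖ ^ 2 := by
    have := mul_nonneg (inv_pos.2 hc).le h3
    have e : c⁻¹ * (c ^ 2 * ‖x - m‖ ^ 2 - 2 * (c * inner ℝ (x - m) y) + ‖y‖ ^ 2)
        = c * ‖x - m‖ ^ 2 - 2 * inner ℝ (x - m) y + c⁻¹ * ‖y‖ ^ 2 := by
      field_simp
    linarith
  linarith

lemma le_wasserstein_sq_isotropicGaussian (hs : 0 < s) (hs₀ : 0 < s₀) :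
    ENNReal.ofReal (‖m‖ ^ 2 + n * (√s - √s₀) ^ 2)
      ≤ wasserstein (isotropicGaussian m s) (isotropicGaussian 0 s₀) ^ 2 := by
  rw [wasserstein_sq]
  refine le_iInf₂ fun π hπ => ?_
  have : IsProbabilityMeasure π := by
    refine ⟨?_⟩
    rw [← Set.preimage_univ (f := Prod.fst), ← Measure.map_apply measurable_fst MeasurableSet.univ,
      hπ.1, measure_univ]
  -- The optimal slope: Young's inequality is an equality when `y = c (x - m)`, which is the linear
  -- coupling above.
  set c : ℝ := √(s₀ / s) with hc
  have hc0 : 0 < c := Real.sqrt_pos.2 (by positivity)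
  have hmp1 : MeasurePreserving Prod.fst π (isotropicGaussian m s) := ⟨measurable_fst, hπ.1⟩
  have hmp2 : MeasurePreserving Prod.snd π (isotropicGaussian 0 s₀) := ⟨measurable_snd, hπ.2⟩
  have key1 : ∀ {g : EuclideanSpace ℝ (Fin n) → ℝ}, Integrable g (isotropicGaussian m s) →
      Integrable (fun p : _ × _ => g p.1) π ∧
        ∫ p : _ × _, g p.1 ∂π = ∫ x, g x ∂(isotropicGaussian m s) := fun {g} hg => by
    refine ⟨hmp1.integrable_comp_of_integrable hg, ?_⟩
    rw [← hπ.1, integral_map (by fun_prop) (by rw [hπ.1]; exact hg.aestronglyMeasurable)]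
  have key2 : ∀ {g : EuclideanSpace ℝ (Fin n) → ℝ}, Integrable g (isotropicGaussian 0 s₀) →
      Integrable (fun p : _ × _ => g p.2) π ∧
        ∫ p : _ × _, g p.2 ∂π = ∫ x, g x ∂(isotropicGaussian 0 s₀) := fun {g} hg => by
    refine ⟨hmp2.integrable_comp_of_integrable hg, ?_⟩
    rw [← hπ.2, integral_map (by fun_prop) (by rw [hπ.2]; exact hg.aestronglyMeasurable)]
  have a1 := key1 (integrable_norm_sub_sq_isotropicGaussian m m)
  have a2 := key1 (integrable_inner_sub_isotropicGaussian m m m)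
  have a3 := key2 (integrable_norm_sub_sq_isotropicGaussian 0 0)
  have a4 := key2 (integrable_inner_sub_isotropicGaussian 0 m 0)
  rw [integral_norm_sub_sq_isotropicGaussian m hs.le] at a1
  rw [integral_inner_sub_isotropicGaussian] at a2
  rw [integral_norm_sub_sq_isotropicGaussian 0 hs₀.le] at a3
  rw [integral_inner_sub_isotropicGaussian] at a4
  simp only [sub_zero] at a3 a4
  have b1 : Integrable (fun p : EuclideanSpace ℝ (Fin n) × EuclideanSpace ℝ (Fin n) =>
      ‖m‖ ^ 2 + 2 * inner ℝ (p.1 - m) m) π := (integrable_const _).add (a2.1.const_mul 2)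
  have b2 : Integrable (fun p : EuclideanSpace ℝ (Fin n) × EuclideanSpace ℝ (Fin n) =>
      ‖m‖ ^ 2 + 2 * inner ℝ (p.1 - m) m - 2 * inner ℝ p.2 m) π := b1.sub (a4.1.const_mul 2)
  have b3 : Integrable (fun p : EuclideanSpace ℝ (Fin n) × EuclideanSpace ℝ (Fin n) =>
      ‖m‖ ^ 2 + 2 * inner ℝ (p.1 - m) m - 2 * inner ℝ p.2 m + (1 - c) * ‖p.1 - m‖ ^ 2) π :=
    b2.add (a1.1.const_mul _)
  have b4 : Integrable (fun p : EuclideanSpace ℝ (Fin n) × EuclideanSpace ℝ (Fin n) =>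
      ‖m‖ ^ 2 + 2 * inner ℝ (p.1 - m) m - 2 * inner ℝ p.2 m + (1 - c) * ‖p.1 - m‖ ^ 2
        + (1 - c⁻¹) * ‖p.2‖ ^ 2) π := b3.add (a3.1.const_mul _)
  have hval : ‖m‖ ^ 2 + n * (√s - √s₀) ^ 2 = ∫ p : EuclideanSpace ℝ (Fin n) ×
      EuclideanSpace ℝ (Fin n), (‖m‖ ^ 2 + 2 * inner ℝ (p.1 - m) m - 2 * inner ℝ p.2 m
        + (1 - c) * ‖p.1 - m‖ ^ 2 + (1 - c⁻¹) * ‖p.2‖ ^ 2) ∂π := by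
    rw [integral_add b3 (a3.1.const_mul _), integral_add b2 (a1.1.const_mul _),
      integral_sub b1 (a4.1.const_mul 2), integral_add (integrable_const _) (a2.1.const_mul 2),
      integral_const_mul, integral_const_mul, integral_const_mul, integral_const_mul,
      a1.2, a2.2, a3.2, a4.2, hc, Real.sqrt_div hs₀.le]
    have e1 := Real.sq_sqrt hs.le
    have e2 := Real.sq_sqrt hs₀.le
    have p1 := Real.sqrt_pos.2 hs
    have p2 := Real.sqrt_pos.2 hs₀
    have q1 : √s₀ / √s * s = √s * √s₀ := by
      rw [div_mul_eq_mul_div, div_eq_iff p1.ne']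
      nlinarith
    have q2 : (√s₀ / √s)⁻¹ * s₀ = √s * √s₀ := by
      rw [inv_div, div_mul_eq_mul_div, div_eq_iff p2.ne']
      nlinarith
    simp only [integral_const, probReal_univ, one_smul]
    linear_combination (n : ℝ) * e1 + (n : ℝ) * e2 + (n : ℝ) * q1 + (n : ℝ) * q2
  rw [hval]
  refine (ofReal_integral_le_lintegral_ofReal b4).trans (lintegral_mono fun p => ?_)
  rw [edist_eq_enorm_sub, ← ofReal_norm, ← ENNReal.ofReal_pow (norm_nonneg _)]
  exact ENNReal.ofReal_le_ofReal (one_sub_mul_norm_sq_le p.1 p.2 m hc0)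

end Wasserstein

/-! ### The critical time of `A² e^{-2t} + B² e^{-4t}` -/

section CriticalTime

/-- Bounds on `A² e^{-2t} + B² e^{-4t}` in terms of the critical time `log A ∨ ½ log B`. -/
lemma sq_mul_exp_add_le {A B c : ℝ} (hA : 0 ≤ A) (hB : 1 < B)
    (hc : c = Real.log A ⊔ (1 / 2 * Real.log B)) (t : ℝ) :
    A ^ 2 * Real.exp (-2 * t) + B ^ 2 * Real.exp (-4 * t)
      ≤ Real.exp (2 * (c - t)) + Real.exp (4 * (c - t)) := by
  have hA' : A ≤ Real.exp c := by
    rcases hA.eq_or_lt with rfl | hA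
    · exact (Real.exp_pos c).le
    · rw [← Real.log_le_iff_le_exp hA, hc]
      exact le_max_left _ _
  have hB' : B ≤ Real.exp (2 * c) := by
    rw [← Real.log_le_iff_le_exp (by linarith), hc]
    linarith [le_max_right (Real.log A) (1 / 2 * Real.log B)]
  rw [show 2 * (c - t) = (2 : ℕ) * c + -2 * t by push_cast; ring,
    show 4 * (c - t) = (2 : ℕ) * (2 * c) + -4 * t by push_cast; ring, Real.exp_add, Real.exp_add,
    Real.exp_nat_mul, Real.exp_nat_mul]
  gcongr

/-- The term attaining the maximum suffices: the first equals `e^{2(c-t)}` if `c = log A`, and the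
second equals `e^{4(c-t)} ≥ e^{2(c-t)}` otherwise. -/
lemma exp_le_sq_mul_exp_add {A B c t : ℝ} (hA : 0 ≤ A) (hB : 1 < B)
    (hc : c = Real.log A ⊔ (1 / 2 * Real.log B)) (htc : t ≤ c) :
    Real.exp (2 * (c - t)) ≤ A ^ 2 * Real.exp (-2 * t) + B ^ 2 * Real.exp (-4 * t) := by
  have hlogB := Real.log_pos hB
  rcases max_choice (Real.log A) (1 / 2 * Real.log B) with h | h
  -- If `A = 0`, the convention `log 0 = 0` would contradict `0 < ½ log B ≤ log A`.
  · have hA0 : 0 < A := by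
      refine hA.lt_of_ne fun h0 => ?_
      have := le_max_right (Real.log A) (1 / 2 * Real.log B)
      rw [h, ← h0, Real.log_zero] at this
      linarith
    rw [h] at hc
    have : Real.exp (2 * (c - t)) = A ^ 2 * Real.exp (-2 * t) := by
      rw [show 2 * (c - t) = (2 : ℕ) * c + -2 * t by push_cast; ring, Real.exp_add,
        Real.exp_nat_mul, hc, Real.exp_log hA0]
    rw [this]
    exact le_add_of_nonneg_right (by positivity)
  · rw [h] at hc
    have h2c : 2 * c = Real.log B := by rw [hc]; ring
    have : Real.exp (4 * (c - t)) = B ^ 2 * Real.exp (-4 * t) := by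
      rw [show 4 * (c - t) = (2 : ℕ) * (2 * c) + -4 * t by push_cast; ring, Real.exp_add,
        Real.exp_nat_mul, h2c, Real.exp_log (by linarith)]
    rw [← this]
    exact (Real.exp_le_exp.2 (by linarith)).trans (le_add_of_nonneg_left (by positivity))

variable {A B c : ℕ → ℝ}

lemma tendsto_criticalTime (hB : Tendsto B atTop atTop)
    (hc : ∀ n, c n = Real.log (A n) ⊔ (1 / 2 * Real.log (B n))) : Tendsto c atTop atTop := by
  have h := (Real.tendsto_log_atTop.comp hB).const_mul_atTop (show (0 : ℝ) < 1 / 2 by norm_num)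
  exact tendsto_atTop_mono (fun n => (le_max_right _ _).trans_eq (hc n).symm) h

lemma tendsto_sq_mul_exp_add_zero (hA : ∀ n, 0 ≤ A n) (hB : Tendsto B atTop atTop)
    (hc : ∀ n, c n = Real.log (A n) ⊔ (1 / 2 * Real.log (B n))) {ε : ℝ} (hε : 0 < ε) :
    Tendsto (fun n => A n ^ 2 * Real.exp (-2 * ((1 + ε) * c n).toNNReal)
      + B n ^ 2 * Real.exp (-4 * ((1 + ε) * c n).toNNReal)) atTop (𝓝 0) := by
  have hct := tendsto_criticalTime hB hc
  have hlim : ∀ k : ℝ, 0 < k → Tendsto (fun n => Real.exp (-(k * c n))) atTop (𝓝 0) := fun k hk =>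
    Real.tendsto_exp_neg_atTop_nhds_zero.comp (hct.const_mul_atTop hk)
  have hbound : Tendsto (fun n => Real.exp (-(2 * ε * c n)) + Real.exp (-(4 * ε * c n))) atTop
      (𝓝 0) := by
    simpa using (hlim (2 * ε) (by positivity)).add (hlim (4 * ε) (by positivity))
  refine squeeze_zero' (Eventually.of_forall fun n => by positivity) ?_ hbound
  -- Once `c n > 0`, the truncation of times at `0` has no effect.
  filter_upwards [hB.eventually_gt_atTop 1, hct.eventually_gt_atTop 0] with n hn hcn
  rw [Real.coe_toNNReal _ (by positivity)]
  refine (sq_mul_exp_add_le (hA n) hn (hc n) _).trans_eq ?_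
  congr 2 <;> ring

lemma tendsto_sq_mul_exp_add_atTop (hA : ∀ n, 0 ≤ A n) (hB : Tendsto B atTop atTop)
    (hc : ∀ n, c n = Real.log (A n) ⊔ (1 / 2 * Real.log (B n))) {ε : ℝ} (hε : 0 < ε)
    (hε1 : ε < 1) :
    Tendsto (fun n => A n ^ 2 * Real.exp (-2 * ((1 - ε) * c n).toNNReal)
      + B n ^ 2 * Real.exp (-4 * ((1 - ε) * c n).toNNReal)) atTop atTop := by
  have hct := tendsto_criticalTime hB hc
  refine tendsto_atTop_mono' _ ?_ (Real.tendsto_exp_atTop.comp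
    (hct.const_mul_atTop (show 0 < 2 * ε by positivity)))
  filter_upwards [hB.eventually_gt_atTop 1, hct.eventually_gt_atTop 0] with n hn hcn
  have h1ε : 0 < 1 - ε := by linarith
  rw [Real.coe_toNNReal _ (by positivity)]
  refine le_trans (le_of_eq ?_) (exp_le_sq_mul_exp_add (hA n) hn (hc n)
    (t := (1 - ε) * c n) (by nlinarith))
  simp only [Function.comp_apply]
  congr 1
  ring

end CriticalTime

/-! ### Limits of the divergences in terms of `a` and `m` -/

section Limits

variable {m : (n : ℕ) → EuclideanSpace ℝ (Fin n)} {a : ℕ → ℝ}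

lemma tendsto_chiSquare_zero (ha : ∀ n, 0 ≤ a n)
    (hQ : Tendsto (fun n => n * a n ^ 2 + n * ‖m n‖ ^ 2) atTop (𝓝 0)) :
    Tendsto (fun n : ℕ => chiSquare (isotropicGaussian (m n) ((n : ℝ)⁻¹ * (1 - a n)))
      (invariantLaw n)) atTop (𝓝 0) := by
  have hlim : Tendsto (fun n => ENNReal.ofReal
      (Real.exp (n * a n ^ 2 + n * ‖m n‖ ^ 2) - 1)) atTop (𝓝 0) := by
    have := ENNReal.tendsto_ofReal (((Real.continuous_exp.tendsto 0).comp hQ).sub_const 1)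
    simpa using this
  refine tendsto_of_tendsto_of_tendsto_of_le_of_le' tendsto_const_nhds hlim
    (Eventually.of_forall fun n => zero_le) ?_
  filter_upwards [eventually_ge_atTop 1, hQ.eventually_le_const (show (0 : ℝ) < 1 / 2 by norm_num)]
    with n hn hn2
  have hn' : (1 : ℝ) ≤ n := by exact_mod_cast hn
  have ha2 : a n ^ 2 ≤ 1 / 2 := by
    nlinarith [sq_nonneg (a n), mul_nonneg (zero_le_one.trans hn') (sq_nonneg ‖m n‖)]
  refine (chiSquare_isotropicGaussian_le (m n) (ha n) ha2 (by positivity)).trans_eq ?_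
  rw [div_inv_eq_mul, mul_comm (‖m n‖ ^ 2)]

lemma tendsto_zero_of_le_chiSquare {d : (n : ℕ) → ℝ≥0∞} (ha : ∀ n, 0 ≤ a n)
    (hQ : Tendsto (fun n => n * a n ^ 2 + n * ‖m n‖ ^ 2) atTop (𝓝 0))
    (hd : ∀ᶠ n : ℕ in atTop, d n ≤ chiSquare (isotropicGaussian (m n) ((n : ℝ)⁻¹ * (1 - a n)))
      (invariantLaw n) ^ (1 / 2 : ℝ)) :
    Tendsto d atTop (𝓝 0) := by
  have h := (ENNReal.continuous_rpow_const (y := 1 / 2)).tendsto 0 |>.comp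
    (tendsto_chiSquare_zero ha hQ)
  rw [ENNReal.zero_rpow_of_pos (by norm_num)] at h
  exact tendsto_of_tendsto_of_tendsto_of_le_of_le' tendsto_const_nhds h
    (Eventually.of_forall fun n => zero_le) hd

lemma eventually_exists_isPosDensity (ha1 : ∀ᶠ n in atTop, a n < 1) :
    ∀ᶠ n : ℕ in atTop, ∃ f, IsPosDensity f (invariantLaw n) ∧
      densityMeasure f (invariantLaw n) = isotropicGaussian (m n) ((n : ℝ)⁻¹ * (1 - a n)) ∧
      (0 ≤ a n → ∫ x, √(f x) ∂(invariantLaw n)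
        ≤ Real.exp (-(n * a n ^ 2 + n * ‖m n‖ ^ 2) / 16)) := by
  filter_upwards [ha1, eventually_ge_atTop 1] with n ha hn
  have hn' : (0 : ℝ) < n := by exact_mod_cast hn
  have h1a : 0 < 1 - a n := by linarith
  refine ⟨likelihoodRatio (m n) ((n : ℝ)⁻¹ * (1 - a n)) (n : ℝ)⁻¹,
    isPosDensity_likelihoodRatio _ (by positivity) (by positivity),
    densityMeasure_likelihoodRatio _ (by positivity) (by positivity), fun ha0 => ?_⟩
  refine (integral_sqrt_likelihoodRatio_le (m n) ha0 ha (inv_pos.2 hn')).trans_eq ?_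
  rw [div_inv_eq_mul, mul_comm (‖m n‖ ^ 2)]

instance (n : ℕ) : IsProbabilityMeasure (invariantLaw n) := by
  unfold invariantLaw
  infer_instance

lemma tendsto_eval_zero {d : Dist} (hdw : d ≠ .wasserstein) (hdf : d ≠ .fisher)
    (ha : ∀ n, 0 ≤ a n)
    (hQ : Tendsto (fun n => n * a n ^ 2 + n * ‖m n‖ ^ 2) atTop (𝓝 0)) :
    Tendsto (fun n : ℕ => d.eval (isotropicGaussian (m n) ((n : ℝ)⁻¹ * (1 - a n)))
      (invariantLaw n)) atTop (𝓝 0) := by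
  -- For `n ≥ 1`, `a² ≤ n a² + n |m|²`, which is eventually below `1`.
  have ha1 : ∀ᶠ n in atTop, a n < 1 := by
    filter_upwards [eventually_ge_atTop 1, hQ.eventually_lt_const one_pos] with n hn hn1
    have hn' : (1 : ℝ) ≤ n := by exact_mod_cast hn
    nlinarith [ha n, sq_nonneg (a n), mul_nonneg (zero_le_one.trans hn') (sq_nonneg ‖m n‖)]
  have hdens := eventually_exists_isPosDensity (m := m) ha1
  cases d with
  | wasserstein => exact absurd rfl hdw
  | fisher => exact absurd rfl hdf
  | tv =>
    refine tendsto_zero_of_le_chiSquare ha hQ ?_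
    filter_upwards [hdens] with n ⟨f, hf, hfμ, _⟩
    rw [← hfμ]
    exact hf.totalVariation_le_chiSquare
  | hellinger =>
    refine tendsto_zero_of_le_chiSquare ha hQ ?_
    filter_upwards [hdens] with n ⟨f, hf, hfμ, _⟩
    rw [← hfμ]
    exact hf.hellinger_le_chiSquare
  | kullback =>
    refine tendsto_of_tendsto_of_tendsto_of_le_of_le' tendsto_const_nhds
      (tendsto_chiSquare_zero ha hQ) (Eventually.of_forall fun n => zero_le) ?_
    filter_upwards [hdens] with n ⟨f, hf, hfμ, _⟩
    rw [← hfμ]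
    exact hf.klDiv_le_chiSquare
  | chiSquare => exact tendsto_chiSquare_zero ha hQ

lemma tendsto_eval_max {d : Dist} (hdw : d ≠ .wasserstein) (hdf : d ≠ .fisher)
    (ha : ∀ n, 0 ≤ a n) (ha1 : ∀ᶠ n in atTop, a n < 1)
    (hQ : Tendsto (fun n => n * a n ^ 2 + n * ‖m n‖ ^ 2) atTop atTop) :
    Tendsto (fun n : ℕ => d.eval (isotropicGaussian (m n) ((n : ℝ)⁻¹ * (1 - a n)))
      (invariantLaw n)) atTop (𝓝 d.max) := by
  have hdens := eventually_exists_isPosDensity (m := m) ha1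
  have hBC : Tendsto (fun n => ENNReal.ofReal
      (1 - Real.exp (-(n * a n ^ 2 + n * ‖m n‖ ^ 2) / 16))) atTop (𝓝 1) := by
    have h1 : Tendsto (fun n => Real.exp (-(n * a n ^ 2 + n * ‖m n‖ ^ 2) / 16)) atTop (𝓝 0) := by
      simp_rw [neg_div]
      exact Real.tendsto_exp_neg_atTop_nhds_zero.comp (hQ.atTop_div_const (by norm_num))
    simpa using ENNReal.tendsto_ofReal (h1.const_sub 1)
  have hBC' : Tendsto (fun n => ENNReal.ofReal
      (1 - Real.exp (-(n * a n ^ 2 + n * ‖m n‖ ^ 2) / 16)) ^ (1 / 2 : ℝ)) atTop (𝓝 1) := by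
    have h := ((ENNReal.continuous_rpow_const (y := 1 / 2)).tendsto 1).comp hBC
    rwa [ENNReal.one_rpow] at h
  -- The bound `b ≤ e^{-Q/16}` gives `-2 log b ≥ Q/8`.
  have hKL : Tendsto (fun n : ℕ => InformationTheory.klDiv
      (isotropicGaussian (m n) ((n : ℝ)⁻¹ * (1 - a n))) (invariantLaw n)) atTop (𝓝 ∞) := by
    refine tendsto_nhds_top_mono (ENNReal.tendsto_ofReal_atTop.comp
      (hQ.atTop_div_const (show (0 : ℝ) < 8 by norm_num))) ?_
    filter_upwards [hdens] with n ⟨f, hf, hfμ, hfBC⟩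
    rw [← hfμ]
    refine le_trans (ENNReal.ofReal_le_ofReal ?_) hf.ofReal_neg_log_le_klDiv
    have := Real.log_le_log hf.integral_sqrt_pos (hfBC (ha n))
    rw [Real.log_exp] at this
    linarith
  cases d with
  | wasserstein => exact absurd rfl hdw
  | fisher => exact absurd rfl hdf
  | tv =>
    refine tendsto_of_tendsto_of_tendsto_of_le_of_le' hBC tendsto_const_nhds ?_ ?_
    · filter_upwards [hdens] with n ⟨f, hf, hfμ, hfBC⟩
      rw [← hfμ]
      exact (ENNReal.ofReal_le_ofReal (sub_le_sub_left (hfBC (ha n)) 1)).trans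
        hf.ofReal_one_sub_le_totalVariation
    · filter_upwards [hdens] with n ⟨f, hf, hfμ, _⟩
      rw [← hfμ]
      exact hf.totalVariation_le_one
  | hellinger =>
    refine tendsto_of_tendsto_of_tendsto_of_le_of_le' hBC' tendsto_const_nhds ?_ ?_
    · filter_upwards [hdens] with n ⟨f, hf, hfμ, hfBC⟩
      rw [← hfμ]
      simp only [Dist.eval]
      rw [hf.hellinger_eq]
      exact ENNReal.rpow_le_rpow
        (ENNReal.ofReal_le_ofReal (sub_le_sub_left (hfBC (ha n)) 1)) (by norm_num)
    · filter_upwards [hdens] with n ⟨f, hf, hfμ, _⟩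
      rw [← hfμ]
      simp only [Dist.eval]
      rw [hf.hellinger_eq]
      refine ENNReal.rpow_le_one ?_ (by norm_num)
      rw [← ENNReal.ofReal_one]
      exact ENNReal.ofReal_le_ofReal (by linarith [hf.integral_sqrt_pos])
  | kullback => exact hKL
  | chiSquare =>
    refine tendsto_nhds_top_mono hKL ?_
    filter_upwards [hdens] with n ⟨f, hf, hfμ, _⟩
    rw [← hfμ]
    exact hf.klDiv_le_chiSquare

lemma eventually_fisher_eq (ha1 : ∀ᶠ n in atTop, a n < 1) :
    ∀ᶠ n : ℕ in atTop, fisher (isotropicGaussian (m n) ((n : ℝ)⁻¹ * (1 - a n))) (invariantLaw n)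
      = ENNReal.ofReal ((n : ℝ) ^ 2 * a n ^ 2 / (1 - a n) + (n : ℝ) ^ 2 * ‖m n‖ ^ 2) := by
  filter_upwards [ha1, eventually_ge_atTop 1] with n ha hn
  have hn' : (0 : ℝ) < n := by exact_mod_cast hn
  have h1a : 0 < 1 - a n := by linarith
  refine (fisher_isotropicGaussian_mul_one_sub (m n) ha (inv_pos.2 hn')).trans ?_
  congr 1
  field_simp

lemma tendsto_fisher_zero
    (hQ : Tendsto (fun n : ℕ => (n : ℝ) ^ 2 * a n ^ 2 + (n : ℝ) ^ 2 * ‖m n‖ ^ 2) atTop (𝓝 0)) :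
    Tendsto (fun n : ℕ => fisher (isotropicGaussian (m n) ((n : ℝ)⁻¹ * (1 - a n)))
      (invariantLaw n)) atTop (𝓝 0) := by
  -- This keeps the factor `1 / (1 - a)` of the Fisher information at most `2`.
  have ha2 : ∀ᶠ n in atTop, a n ≤ 1 / 2 := by
    filter_upwards [eventually_ge_atTop 1,
      hQ.eventually_lt_const (show (0 : ℝ) < 1 / 4 by norm_num)] with n hn hn1
    have hn' : (1 : ℝ) ≤ (n : ℝ) ^ 2 := one_le_pow₀ (by exact_mod_cast hn)
    nlinarith [sq_nonneg (a n), mul_nonneg (zero_le_one.trans hn') (sq_nonneg ‖m n‖)]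
  have hlim : Tendsto (fun n : ℕ => ENNReal.ofReal
      (2 * ((n : ℝ) ^ 2 * a n ^ 2 + (n : ℝ) ^ 2 * ‖m n‖ ^ 2))) atTop (𝓝 0) := by
    simpa using ENNReal.tendsto_ofReal (hQ.const_mul 2)
  refine tendsto_of_tendsto_of_tendsto_of_le_of_le' tendsto_const_nhds hlim
    (Eventually.of_forall fun n => zero_le) ?_
  filter_upwards [ha2, eventually_fisher_eq (m := m) (ha2.mono fun n hn => by linarith)]
    with n hn hF
  rw [hF]
  refine ENNReal.ofReal_le_ofReal ?_
  have h1 : (n : ℝ) ^ 2 * a n ^ 2 / (1 - a n) ≤ 2 * ((n : ℝ) ^ 2 * a n ^ 2) := by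
    rw [div_le_iff₀ (by linarith)]
    nlinarith [mul_nonneg (sq_nonneg (n : ℝ)) (sq_nonneg (a n))]
  nlinarith [mul_nonneg (sq_nonneg (n : ℝ)) (sq_nonneg ‖m n‖)]

lemma tendsto_fisher_top (ha : ∀ n, 0 ≤ a n) (ha1 : ∀ᶠ n in atTop, a n < 1)
    (hQ : Tendsto (fun n : ℕ => (n : ℝ) ^ 2 * a n ^ 2 + (n : ℝ) ^ 2 * ‖m n‖ ^ 2) atTop atTop) :
    Tendsto (fun n : ℕ => fisher (isotropicGaussian (m n) ((n : ℝ)⁻¹ * (1 - a n)))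
      (invariantLaw n)) atTop (𝓝 ∞) := by
  refine tendsto_nhds_top_mono (ENNReal.tendsto_ofReal_atTop.comp hQ) ?_
  filter_upwards [ha1, eventually_fisher_eq (m := m) ha1] with n hn hF
  rw [hF]
  refine ENNReal.ofReal_le_ofReal (add_le_add_left ?_ _)
  exact le_div_self (by positivity) (by linarith) (by linarith [ha n])

/-- The case `b = 1`, a Dirac mass at time `0`, is included: the upper bound needs no density. -/
lemma wasserstein_sq_invariantLaw_le {n : ℕ} (hn : 1 ≤ n) (v : EuclideanSpace ℝ (Fin n)) {b : ℝ}
    (hb : b ≤ 1) :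
    wasserstein (isotropicGaussian v ((n : ℝ)⁻¹ * (1 - b))) (invariantLaw n) ^ 2
      ≤ ENNReal.ofReal (‖v‖ ^ 2 + (1 - √(1 - b)) ^ 2) := by
  have hn' : (0 : ℝ) < n := by exact_mod_cast hn
  have h1b : 0 ≤ 1 - b := by linarith
  refine (wasserstein_sq_isotropicGaussian_le v (by positivity) (inv_pos.2 hn').le).trans_eq ?_
  rw [Real.sqrt_mul (inv_pos.2 hn').le]
  congr 2
  have := Real.sq_sqrt (inv_pos.2 hn').le
  rw [show (√(n : ℝ)⁻¹ * √(1 - b) - √(n : ℝ)⁻¹) ^ 2 = √(n : ℝ)⁻¹ ^ 2 * (1 - √(1 - b)) ^ 2 by ring,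
    this]
  field_simp

lemma wasserstein_sq_invariantLaw {n : ℕ} (hn : 1 ≤ n) (v : EuclideanSpace ℝ (Fin n)) {b : ℝ}
    (hb : b < 1) :
    wasserstein (isotropicGaussian v ((n : ℝ)⁻¹ * (1 - b))) (invariantLaw n) ^ 2
      = ENNReal.ofReal (‖v‖ ^ 2 + (1 - √(1 - b)) ^ 2) := by
  refine (wasserstein_sq_invariantLaw_le hn v hb.le).antisymm ?_
  have hn' : (0 : ℝ) < n := by exact_mod_cast hn
  have h1b : 0 < 1 - b := by linarith
  refine le_trans (le_of_eq ?_)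
    (le_wasserstein_sq_isotropicGaussian v (by positivity) (inv_pos.2 hn'))
  rw [Real.sqrt_mul (inv_pos.2 hn').le]
  congr 2
  have := Real.sq_sqrt (inv_pos.2 hn').le
  rw [show (√(n : ℝ)⁻¹ * √(1 - b) - √(n : ℝ)⁻¹) ^ 2 = √(n : ℝ)⁻¹ ^ 2 * (1 - √(1 - b)) ^ 2 by ring,
    this]
  field_simp

lemma tendsto_of_tendsto_sq {w : ℕ → ℝ≥0∞} {l : ℝ≥0∞}
    (h : Tendsto (fun n => w n ^ 2) atTop (𝓝 (l ^ 2))) : Tendsto w atTop (𝓝 l) := by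
  have hsqrt : ∀ x : ℝ≥0∞, (x ^ 2) ^ (1 / 2 : ℝ) = x := fun x => by
    rw [← ENNReal.rpow_natCast, ← ENNReal.rpow_mul]
    norm_num
  have := ((ENNReal.continuous_rpow_const (y := 1 / 2)).tendsto _).comp h
  simpa only [Function.comp_def, hsqrt] using this

end Limits

/-! ### Cutoff for the Ornstein–Uhlenbeck process -/

section CutoffResults

variable {Ω : ℕ → Type*} [∀ n, MeasurableSpace (Ω n)] {P : ∀ n, Measure (Ω n)}
  [∀ n, IsProbabilityMeasure (P n)] {z₀ : (n : ℕ) → EuclideanSpace ℝ (Fin n)}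
  {B Z : (n : ℕ) → ℝ≥0 → Ω n → EuclideanSpace ℝ (Fin n)}

lemma map_ouProcess_eq (hB : ∀ n, IsStdBrownian (B n) (P n))
    (hZ : ∀ n, IsOUProcess (z₀ n) (B n) (Z n) (P n)) (n : ℕ) (t : ℝ≥0) :
    (P n).map (Z n t)
      = isotropicGaussian (Real.exp (-t) • z₀ n) ((n : ℝ)⁻¹ * (1 - Real.exp (-2 * t))) := by
  rw [IsOUProcess.map_eq (hB n) (hZ n) t, div_eq_inv_mul]

lemma norm_exp_neg_smul_sq {E : Type*} [NormedAddCommGroup E] [NormedSpace ℝ E] (z : E) (t : ℝ) :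
    ‖Real.exp (-t) • z‖ ^ 2 = Real.exp (-2 * t) * ‖z‖ ^ 2 := by
  rw [norm_smul, mul_pow, Real.norm_eq_abs, sq_abs, ← Real.exp_nat_mul]
  congr 2
  push_cast
  ring

lemma exp_neg_two_mul_sq (t : ℝ) : Real.exp (-2 * t) ^ 2 = Real.exp (-4 * t) := by
  rw [← Real.exp_nat_mul]
  congr 1
  push_cast
  ring

lemma exp_neg_two_mul_lt_one {t : ℝ} (ht : 0 < t) : Real.exp (-2 * t) < 1 := by
  rw [← Real.exp_zero]
  exact Real.exp_lt_exp.2 (by linarith)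

lemma hasCutoff_of_ne_wasserstein (hB : ∀ n, IsStdBrownian (B n) (P n))
    (hZ : ∀ n, IsOUProcess (z₀ n) (B n) (Z n) (P n)) {d : Dist} (hdw : d ≠ .wasserstein)
    (hdf : d ≠ .fisher) :
    HasCutoff d (fun n t => (P n).map (Z n t)) invariantLaw
      (fun n => d.criticalTime n ‖z₀ n‖) := by
  have hsqrt : Tendsto (fun n : ℕ => √(n : ℝ)) atTop atTop :=
    Real.tendsto_sqrt_atTop.comp tendsto_natCast_atTop_atTop
  have hA : ∀ n : ℕ, 0 ≤ √(n : ℝ) * ‖z₀ n‖ := fun n => by positivity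
  -- With `B = √n`, the term `½ log B` is `¼ log n`.
  have hc : ∀ n : ℕ, d.criticalTime n ‖z₀ n‖
      = Real.log (√(n : ℝ) * ‖z₀ n‖) ⊔ (1 / 2 * Real.log (√(n : ℝ))) := fun n => by
    have : 1 / 2 * Real.log (√(n : ℝ)) = 1 / 4 * Real.log n := by
      rw [Real.log_sqrt (Nat.cast_nonneg n)]
      ring
    rw [this]
    cases d <;> first | exact absurd rfl hdw | exact absurd rfl hdf | rfl
  have hQ : ∀ (n : ℕ) (t : ℝ), (√(n : ℝ) * ‖z₀ n‖) ^ 2 * Real.exp (-2 * t)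
      + √(n : ℝ) ^ 2 * Real.exp (-4 * t)
      = n * Real.exp (-2 * t) ^ 2 + n * ‖Real.exp (-t) • z₀ n‖ ^ 2 := fun n t => by
    rw [norm_exp_neg_smul_sq, exp_neg_two_mul_sq, mul_pow, Real.sq_sqrt (Nat.cast_nonneg n)]
    ring
  intro ε hε hε1
  simp_rw [map_ouProcess_eq hB hZ]
  have hct := tendsto_criticalTime hsqrt hc
  constructor
  · refine tendsto_eval_max hdw hdf (fun n => (Real.exp_pos _).le) ?_ ?_
    · filter_upwards [hct.eventually_gt_atTop 0] with n hn
      have h1ε : 0 < 1 - ε := by linarith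
      exact exp_neg_two_mul_lt_one (NNReal.coe_pos.2 (Real.toNNReal_pos.2 (by positivity)))
    · exact (tendsto_sq_mul_exp_add_atTop hA hsqrt hc hε hε1).congr fun n => hQ n _
  · exact tendsto_eval_zero hdw hdf (fun n => (Real.exp_pos _).le)
      ((tendsto_sq_mul_exp_add_zero hA hsqrt hc hε).congr fun n => hQ n _)

lemma hasCutoff_fisher (hB : ∀ n, IsStdBrownian (B n) (P n))
    (hZ : ∀ n, IsOUProcess (z₀ n) (B n) (Z n) (P n)) :
    HasCutoff .fisher (fun n t => (P n).map (Z n t)) invariantLaw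
      (fun n => Dist.fisher.criticalTime n ‖z₀ n‖) := by
  have hnat : Tendsto (fun n : ℕ => (n : ℝ)) atTop atTop := tendsto_natCast_atTop_atTop
  have hA : ∀ n : ℕ, 0 ≤ (n : ℝ) * ‖z₀ n‖ := fun n => by positivity
  have hc : ∀ n : ℕ, Dist.fisher.criticalTime n ‖z₀ n‖
      = Real.log ((n : ℝ) * ‖z₀ n‖) ⊔ (1 / 2 * Real.log (n : ℝ)) := fun n => rfl
  have hQ : ∀ (n : ℕ) (t : ℝ), ((n : ℝ) * ‖z₀ n‖) ^ 2 * Real.exp (-2 * t)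
      + (n : ℝ) ^ 2 * Real.exp (-4 * t)
      = (n : ℝ) ^ 2 * Real.exp (-2 * t) ^ 2 + (n : ℝ) ^ 2 * ‖Real.exp (-t) • z₀ n‖ ^ 2 :=
    fun n t => by
      rw [norm_exp_neg_smul_sq, exp_neg_two_mul_sq, mul_pow]
      ring
  intro ε hε hε1
  simp_rw [map_ouProcess_eq hB hZ]
  have hct := tendsto_criticalTime hnat hc
  constructor
  · refine tendsto_fisher_top (fun n => (Real.exp_pos _).le) ?_ ?_
    · filter_upwards [hct.eventually_gt_atTop 0] with n hn
      have h1ε : 0 < 1 - ε := by linarith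
      exact exp_neg_two_mul_lt_one (NNReal.coe_pos.2 (Real.toNNReal_pos.2 (by positivity)))
    · exact (tendsto_sq_mul_exp_add_atTop hA hnat hc hε hε1).congr fun n => hQ n _
  · exact tendsto_fisher_zero
      ((tendsto_sq_mul_exp_add_zero hA hnat hc hε).congr fun n => hQ n _)

lemma hasCutoff_wasserstein (hB : ∀ n, IsStdBrownian (B n) (P n))
    (hZ : ∀ n, IsOUProcess (z₀ n) (B n) (Z n) (P n))
    (hz : Tendsto (fun n => ‖z₀ n‖) atTop atTop) :
    HasCutoff .wasserstein (fun n t => (P n).map (Z n t)) invariantLaw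
      (fun n => Dist.wasserstein.criticalTime n ‖z₀ n‖) := by
  have hlog : Tendsto (fun n => Real.log ‖z₀ n‖) atTop atTop := Real.tendsto_log_atTop.comp hz
  -- Both sides of the cutoff at once, with `δ = ∓ε`: the mean contributes `|z₀|² e^{-2t} =
  -- |z₀|^{-2δ}`, which diverges or vanishes according to the sign of `δ`.
  have hsq : ∀ δ : ℝ, 0 < 1 + δ → ∀ᶠ n in atTop,
      wasserstein ((P n).map (Z n ((1 + δ) * Real.log ‖z₀ n‖).toNNReal)) (invariantLaw n) ^ 2
      = ENNReal.ofReal (Real.exp (-(2 * δ * Real.log ‖z₀ n‖))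
        + (1 - √(1 - Real.exp (-(2 * (1 + δ) * Real.log ‖z₀ n‖)))) ^ 2) := fun δ hδ => by
    filter_upwards [hlog.eventually_gt_atTop 0, eventually_ge_atTop 1, hz.eventually_gt_atTop 0]
      with n hn hn1 hr
    have ht : 0 < (1 + δ) * Real.log ‖z₀ n‖ := by positivity
    rw [map_ouProcess_eq hB hZ, Real.coe_toNNReal _ ht.le,
      wasserstein_sq_invariantLaw hn1 _ (exp_neg_two_mul_lt_one ht), norm_exp_neg_smul_sq]
    congr 2
    · have : ‖z₀ n‖ ^ 2 = Real.exp (2 * Real.log ‖z₀ n‖) := by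
        rw [show 2 * Real.log ‖z₀ n‖ = (2 : ℕ) * Real.log ‖z₀ n‖ by push_cast; ring,
          Real.exp_nat_mul, Real.exp_log hr]
      rw [this, ← Real.exp_add]
      congr 1
      ring
    · congr 5
      ring
  intro ε hε hε1
  constructor
  · have h := (ENNReal.tendsto_ofReal_atTop.comp (Real.tendsto_exp_atTop.comp
      (hlog.const_mul_atTop (show 0 < 2 * ε by positivity))))
    refine tendsto_of_tendsto_sq ?_
    rw [show Dist.wasserstein.max ^ 2 = ∞ from ENNReal.top_pow two_ne_zero]
    refine tendsto_nhds_top_mono h ?_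
    filter_upwards [hsq (-ε) (by linarith)] with n hn
    rw [← sub_eq_add_neg] at hn
    refine le_of_le_of_eq (ENNReal.ofReal_le_ofReal ?_) hn.symm
    simp only [Function.comp_apply]
    rw [show -(2 * -ε * Real.log ‖z₀ n‖) = 2 * ε * Real.log ‖z₀ n‖ by ring]
    exact le_add_of_nonneg_right (sq_nonneg _)
  · refine tendsto_of_tendsto_sq ?_
    rw [zero_pow two_ne_zero]
    refine Tendsto.congr' ((hsq ε (by linarith)).mono fun n hn => hn.symm) ?_
    have hlim : ∀ k : ℝ, 0 < k → Tendsto (fun n => Real.exp (-(k * Real.log ‖z₀ n‖))) atTop (𝓝 0) :=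
      fun k hk => Real.tendsto_exp_neg_atTop_nhds_zero.comp (hlog.const_mul_atTop hk)
    have h2 := (((((hlim (2 * (1 + ε)) (by positivity)).const_sub 1).sqrt).const_sub 1).pow 2)
    have := ENNReal.tendsto_ofReal ((hlim (2 * ε) (by positivity)).add h2)
    simpa using this

lemma tendsto_wasserstein_sq (hB : ∀ n, IsStdBrownian (B n) (P n))
    (hZ : ∀ n, IsOUProcess (z₀ n) (B n) (Z n) (P n)) {α : ℝ}
    (hz : Tendsto (fun n => ‖z₀ n‖) atTop (𝓝 α)) {t : ℝ≥0} (ht : 0 < t) :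
    Tendsto (fun n => wasserstein ((P n).map (Z n t)) (invariantLaw n) ^ 2) atTop
      (𝓝 (ENNReal.ofReal (α ^ 2 * Real.exp (-2 * t)
        + 2 * (1 - √(1 - Real.exp (-2 * t)) - 1 / 2 * Real.exp (-2 * t))))) := by
  have ht' := exp_neg_two_mul_lt_one (NNReal.coe_pos.2 ht)
  have heq : (1 - √(1 - Real.exp (-2 * t))) ^ 2
      = 2 * (1 - √(1 - Real.exp (-2 * t)) - 1 / 2 * Real.exp (-2 * t)) := by
    have := Real.sq_sqrt (sub_nonneg.2 ht'.le)
    linear_combination this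
  rw [← heq]
  refine Tendsto.congr' ?_ (ENNReal.tendsto_ofReal
    (((hz.pow 2).mul_const (Real.exp (-2 * t))).add_const ((1 - √(1 - Real.exp (-2 * t))) ^ 2)))
  filter_upwards [eventually_ge_atTop 1] with n hn
  rw [map_ouProcess_eq hB hZ, wasserstein_sq_invariantLaw hn _ ht', norm_exp_neg_smul_sq, mul_comm]

/-- For large `n` the squared distance is at most `(α + 1)² + 1` at every time, so it cannot tend to
`∞` along any sequence of times. -/
lemma not_hasCutoff_wasserstein (hB : ∀ n, IsStdBrownian (B n) (P n))
    (hZ : ∀ n, IsOUProcess (z₀ n) (B n) (Z n) (P n)) {α : ℝ}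
    (hz : Tendsto (fun n => ‖z₀ n‖) atTop (𝓝 α)) (c : ℕ → ℝ) :
    ¬ HasCutoff .wasserstein (fun n t => (P n).map (Z n t)) invariantLaw c := fun h => by
  have h1 := (h (1 / 2) (by norm_num) (by norm_num)).1
  have h2 := (ENNReal.continuous_pow 2).tendsto _ |>.comp h1
  rw [show Dist.wasserstein.max ^ 2 = ∞ from ENNReal.top_pow two_ne_zero] at h2
  refine ENNReal.ofReal_ne_top (top_le_iff.1 (le_of_tendsto h2
    (b := ENNReal.ofReal ((α + 1) ^ 2 + 1)) ?_))
  filter_upwards [eventually_ge_atTop 1, hz.eventually_le_const (lt_add_one α)] with n hn hr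
  simp only [Function.comp_apply, Dist.eval]
  set τ := ((1 - 1 / 2) * c n).toNNReal
  -- The inequality is not strict: `τ = 0` whenever `c n ≤ 0`.
  have hexp : Real.exp (-2 * τ) ≤ 1 := Real.exp_le_one_iff.2 (by simp)
  rw [map_ouProcess_eq hB hZ]
  refine (wasserstein_sq_invariantLaw_le hn _ hexp).trans (ENNReal.ofReal_le_ofReal ?_)
  rw [norm_exp_neg_smul_sq]
  have hs0 := Real.sqrt_nonneg (1 - Real.exp (-2 * τ))
  have hs1 : √(1 - Real.exp (-2 * τ)) ≤ 1 :=
    Real.sqrt_le_one.2 (by linarith [Real.exp_pos (-2 * (τ : ℝ))])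
  refine add_le_add ?_ (by nlinarith)
  exact (mul_le_of_le_one_left (sq_nonneg _) hexp).trans (pow_le_pow_left₀ (norm_nonneg _) hr 2)

end CutoffResults

end OUCutoff

theorem theorem1p2 {Ω : ℕ → Type*} [∀ n, MeasurableSpace (Ω n)]
    (P : ∀ n, Measure (Ω n)) [∀ n, IsProbabilityMeasure (P n)]
    (z₀ : (n : ℕ) → EuclideanSpace ℝ (Fin n))
    (B Z : (n : ℕ) → ℝ≥0 → Ω n → EuclideanSpace ℝ (Fin n))
    (hB : ∀ n, OUCutoff.IsStdBrownian (B n) (P n))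
    (hZ : ∀ n, OUCutoff.IsOUProcess (z₀ n) (B n) (Z n) (P n)) :
    (∀ d : OUCutoff.Dist, d ≠ .wasserstein →
      OUCutoff.HasCutoff d (fun n t => (P n).map (Z n t)) OUCutoff.invariantLaw
        (fun n => d.criticalTime n ‖z₀ n‖)) ∧
    (Tendsto (fun n => ‖z₀ n‖) atTop atTop →
      OUCutoff.HasCutoff .wasserstein (fun n t => (P n).map (Z n t)) OUCutoff.invariantLaw
        (fun n => OUCutoff.Dist.criticalTime .wasserstein n ‖z₀ n‖)) ∧
    (∀ α : ℝ, Tendsto (fun n => ‖z₀ n‖) atTop (𝓝 α) →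
      (¬ ∃ c : ℕ → ℝ,
        OUCutoff.HasCutoff .wasserstein (fun n t => (P n).map (Z n t)) OUCutoff.invariantLaw c) ∧
      ∀ t : ℝ≥0, 0 < t →
        Tendsto (fun n => OUCutoff.wasserstein ((P n).map (Z n t)) (OUCutoff.invariantLaw n) ^ 2)
          atTop (𝓝 (ENNReal.ofReal (α ^ 2 * Real.exp (-2 * t)
            + 2 * (1 - √(1 - Real.exp (-2 * t)) - 1 / 2 * Real.exp (-2 * t)))))) := by
  refine ⟨fun d hd => ?_, OUCutoff.hasCutoff_wasserstein hB hZ, fun α hα =>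
    ⟨fun ⟨c, hc⟩ => OUCutoff.not_hasCutoff_wasserstein hB hZ hα c hc,
      fun t ht => OUCutoff.tendsto_wasserstein_sq hB hZ hα ht⟩⟩
  by_cases hdf : d = .fisher
  · subst hdf
    exact OUCutoff.hasCutoff_fisher hB hZ
  · exact OUCutoff.hasCutoff_of_ne_wasserstein hB hZ hd hdf
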